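/- Let $(M,g_m)$ and $(N,g_n)$ be smooth Riemannian manifolds with $\dim M>\dim N$, with Levi-Civita connections $\nabla$ and $\nabla^N$. Let $(\varphi_*,\zeta,\eta_*,g_m)$ be a Sasakian structure on $M$: $\varphi_*$ is a smooth $(1,1)$-tensor field, $\zeta$ a smooth vector field and $\eta_*$ a $1$-form such that $$\varphi_*^2P=-P+\eta_*(P)\zeta,\quad \varphi_*\zeta=0,\quad \eta_*\circ\varphi_*=0,\quad \eta_*(\zeta)=1,\quad g_m(P,\zeta)=\eta_*(P),$$ $$g_m(\varphi_*P,\varphi_*Q)=g_m(P,Q)-\eta_*(P)\eta_*(Q),\qquad g_m(\varphi_*P,Q)=-g_m(P,\varphi_*Q),$$ $$(\nabla_P\varphi_*)Q=g_m(P,Q)\zeta-\eta_*(Q)P,\qquad \nabla_P\zeta=-\varphi_*P$$ for all vector fields $P,Q$. Let $\Psi:M\to N$ be a semi-invariant conformal $\zeta^\perp$-Riemannian submersion with dilation $\lambda_*:M\to(0,\infty)$. This means that $\Psi$ is a smooth surjective submersion with $g_n(\Psi_*P,\Psi_*Q)=\lambda_*^2\,g_m(P,Q)$ for all $P,Q\in(\ker\Psi_*)^\perp$;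 that $\zeta$ is orthogonal to $\ker\Psi_*$; and that there is a smooth distribution $D_1\subseteq\ker\Psi_*$ with $\varphi_*(D_1)=D_1$ and $\varphi_*(D_2)\subseteq(\ker\Psi_*)^\perp$, where $D_2$ is the orthogonal complement of $D_1$ in $\ker\Psi_*$. Let $\mu$ be the orthogonal complement of $\varphi_*D_2$ in $(\ker\Psi_*)^\perp$. Let $\mathcal V$ and $\mathcal H$ be the orthogonal projections of $TM$ onto $\ker\Psi_*$ and $(\ker\Psi_*)^\perp$. For $V\in\Gamma(\ker\Psi_*)$ write $\varphi_*V=\phi V+\omega V$ with $\phi V=\mathcal V\varphi_*V$ and $\omega V=\mathcal H\varphi_*V$; for $P\in\Gamma((\ker\Psi_*)^\perp)$ put $\beta P=\mathcal H\varphi_*P$. Let $$T_XY=\mathcal H\nabla_{\mathcal VX}\mathcal VY+\mathcal V\nabla_{\mathcal VX}\mathcal HY,\qquad A_XY=\mathcal H\nabla_{\mathcal HX}\mathcal VY+\mathcal V\nabla_{\mathcal HX}\mathcal HY,\qquad \hat\nabla_XY=\mathcal V\nabla_XY,$$ and let $\nabla^\Psi$ be the connection on the pullback bundle $\Psi^{-1}TN$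 induced by $\nabla^N$. Then $\ker\Psi_*$ defines a totally geodesic foliation of $M$ (that is, $\nabla_UV\in\Gamma(\ker\Psi_*)$ for all $U,V\in\Gamma(\ker\Psi_*)$) if and only if both of the following conditions hold: 1. for all $U,V\in\Gamma(\ker\Psi_*)$ and $Z\in\Gamma(\mu)$, $$g_n\big(\nabla^\Psi_{\omega V}\Psi_*Z,\Psi_*\omega U\big)=\lambda_*^2\,g_m\big(\beta T_U\phi V+A_{\omega V}\phi U+g_m(\omega V,\omega U)\,\mathrm{grad}\ln\lambda_*-g_m(\phi U,V)\,\zeta,\;Z\big);$$ 2. for all $U,V\in\Gamma(\ker\Psi_*)$, $\;T_U\omega V+\hat\nabla_U\phi V\in\Gamma(D_1)$. -/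

import Mathlib

open Bundle VectorField
open scoped Manifold ContDiff
noncomputable section
namespace SicSubmersion
variable {E : Type*} [NormedAddCommGroup E] [NormedSpace ℝ E]
  {H : Type*} [TopologicalSpace H] {I : ModelWithCorners ℝ E H}
  {M : Type*} [TopologicalSpace M] [ChartedSpace H M]

instance tangentSpace_finiteDimensional [FiniteDimensional ℝ E] (x : M) :
    FiniteDimensional ℝ (TangentSpace I x) :=
  inferInstanceAs (FiniteDimensional ℝ E)

instance tangentSpace_t2Space (x : M) : T2Space (TangentSpace I x) :=
  inferInstanceAs (T2Space E)

variable [IsManifold I ∞ M]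

/-- The fiberwise bilinear form of a Riemannian metric. -/
def metricForm (g : ContMDiffRiemannianMetric I ∞ E (fun x : M ↦ TangentSpace I x)) (x : M) :
    LinearMap.BilinForm ℝ (TangentSpace I x) :=
  LinearMap.mk₂ ℝ (fun v w ↦ g.inner x v w) (by simp) (by simp) (by simp) (by simp)

variable (g : ContMDiffRiemannianMetric I ∞ E (fun x : M ↦ TangentSpace I x))

theorem metricForm_isSymm (x : M) : (metricForm g x).IsSymm := ⟨fun v w ↦ g.symm x v w⟩

theorem metricForm_restrict_nondegenerate (x : M) (K : Submodule ℝ (TangentSpace I x)) :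
    ((metricForm g x).restrict K).Nondegenerate := by
  have key : ∀ v : K, g.inner x (v : TangentSpace I x) v = 0 → v = 0 := by
    intro v hv
    by_contra hne
    exact (g.pos x v (fun h ↦ hne (Subtype.ext h))).ne' hv
  exact ⟨fun v hv ↦ key v (hv v), fun v hv ↦ key v (hv v)⟩

theorem metricForm_nondegenerate (x : M) : (metricForm g x).Nondegenerate := by
  have key : ∀ v : TangentSpace I x, g.inner x v v = 0 → v = 0 := by
    intro v hv
    by_contra hne
    exact (g.pos x v hne).ne' hv
  exact ⟨fun v hv ↦ key v (hv v), fun v hv ↦ key v (hv v)⟩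

theorem metric_ext {x : M} {u v : TangentSpace I x}
    (h : ∀ w, g.inner x u w = g.inner x v w) : u = v := by
  have := (metricForm_nondegenerate g x).1 (u - v) (fun w ↦ by
    change g.inner x (u - v) w = 0
    simp [h w])
  exact sub_eq_zero.mp this

variable {x : M}

theorem mdiff_metric {Y Z : Π x : M, TangentSpace I x} (hY : MDiffAt (T% Y) x)
    (hZ : MDiffAt (T% Z) x) : MDiffAt (fun y ↦ g.inner y (Y y) (Z y)) x := by
  have : MDifferentiableAt I (I.prod 𝓘(ℝ))
      (fun m ↦ TotalSpace.mk' ℝ (E := Bundle.Trivial M ℝ) m (g.inner m (Y m) (Z m))) x := by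
    apply MDifferentiableAt.clm_bundle_apply₂ (F₁ := E) (F₂ := E)
    · exact (g.contMDiff.mdifferentiable (by simp)) x
    · exact hY
    · exact hZ
  simp only [mdifferentiableAt_totalSpace] at this
  exact this.2

theorem mdiff_extend (v : TangentSpace I x) :
    MDiffAt (T% (FiberBundle.extend E v : Π y : M, TangentSpace I y)) x :=
  FiberBundle.mdifferentiableAt_extend ..

/-- The right-hand side of Koszul's formula. -/
def koszul (X Y Z : Π x : M, TangentSpace I x) (x : M) : ℝ :=
  (1 / 2) * (d% (fun y ↦ g.inner y (Y y) (Z y)) x (X x)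
    + d% (fun y ↦ g.inner y (X y) (Z y)) x (Y x)
    - d% (fun y ↦ g.inner y (X y) (Y y)) x (Z x)
    + g.inner x (mlieBracket I X Y x) (Z x)
    - g.inner x (mlieBracket I X Z x) (Y x)
    - g.inner x (mlieBracket I Y Z x) (X x))

variable [FiniteDimensional ℝ E]

theorem koszul_tensorial_right {X Y : Π x : M, TangentSpace I x} (hX : MDiffAt (T% X) x)
    (hY : MDiffAt (T% Y) x) : TensorialAt I E (koszul g X Y · x) x where
  smul {f σ} hf hσ := by
    have h1 := mvfderiv_fun_mul hf (mdiff_metric g hY hσ)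
    have h2 := mvfderiv_fun_mul hf (mdiff_metric g hX hσ)
    simp [koszul, mlieBracket_smul_right hf hσ, h1, h2]
    rw [g.symm x (σ x) (Y x), g.symm x (σ x) (X x)]
    ring
  add {σ σ'} hσ hσ' := by
    have h1 := mvfderiv_fun_add (mdiff_metric g hY hσ) (mdiff_metric g hY hσ')
    have h2 := mvfderiv_fun_add (mdiff_metric g hX hσ) (mdiff_metric g hX hσ')
    simp [koszul, mlieBracket_add_right hσ hσ', h1, h2]
    ring

theorem koszul_tensorial_left {Y Z : Π x : M, TangentSpace I x} (hY : MDiffAt (T% Y) x)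
    (hZ : MDiffAt (T% Z) x) : TensorialAt I E (koszul g · Y Z x) x where
  smul {f σ} hf hσ := by
    have h1 := mvfderiv_fun_mul hf (mdiff_metric g hσ hZ)
    have h2 := mvfderiv_fun_mul hf (mdiff_metric g hσ hY)
    simp [koszul, mlieBracket_smul_left hf hσ, h1, h2]
    rw [g.symm x (mlieBracket I Y Z x)]
    ring
  add {σ σ'} hσ hσ' := by
    have h1 := mvfderiv_fun_add (mdiff_metric g hσ hZ) (mdiff_metric g hσ' hZ)
    have h2 := mvfderiv_fun_add (mdiff_metric g hσ hY) (mdiff_metric g hσ' hY)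
    simp [koszul, mlieBracket_add_left hσ hσ', h1, h2]
    ring

/-- The musical isomorphism `♯`, from covectors to vectors. -/
def sharp (x : M) : Module.Dual ℝ (TangentSpace I x) →ₗ[ℝ] TangentSpace I x :=
  ((metricForm g x).toDual (metricForm_nondegenerate g x)).symm.toLinearMap

theorem inner_sharp (x : M) (l : Module.Dual ℝ (TangentSpace I x)) (w : TangentSpace I x) :
    g.inner x (sharp g x l) w = l w :=
  (metricForm g x).apply_toDual_symm_apply l w

open Classical in
/-- The map underlying the Levi-Civita connection: for a field `Y` differentiable at `x`,
`leviCivitaFun g Y x v` is the vector whose inner product with `w` is Koszul's expression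
for any differentiable extensions of `v` and `w`. -/
def leviCivitaFun (Y : Π x : M, TangentSpace I x) (x : M) :
    TangentSpace I x →L[ℝ] TangentSpace I x :=
  if hY : MDiffAt (T% Y) x then
    LinearMap.toContinuousLinearMap
      (sharp g x ∘ₗ ContinuousLinearMap.coeLM ℝ ∘ₗ
        (TensorialAt.mkHom₂ (fun X Z ↦ koszul g X Y Z x) x
          (fun _ hZ ↦ koszul_tensorial_left g hY hZ)
          (fun _ hX ↦ koszul_tensorial_right g hX hY)).toLinearMap)
  else 0

/-- Koszul's formula. -/
theorem inner_leviCivitaFun {X Y Z : Π x : M, TangentSpace I x} (hX : MDiffAt (T% X) x)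
    (hY : MDiffAt (T% Y) x) (hZ : MDiffAt (T% Z) x) :
    g.inner x (leviCivitaFun g Y x (X x)) (Z x) = koszul g X Y Z x := by
  simp only [leviCivitaFun, hY, dif_pos]
  refine (inner_sharp g x _ _).trans ?_
  exact TensorialAt.mkHom₂_apply (Φ := fun X Z ↦ koszul g X Y Z x)
    (fun _ hZ ↦ koszul_tensorial_left g hY hZ) (fun _ hX ↦ koszul_tensorial_right g hX hY) hX hZ

theorem leviCivitaFun_ext {Y : Π x : M, TangentSpace I x} (hY : MDiffAt (T% Y) x)
    {L : TangentSpace I x →L[ℝ] TangentSpace I x}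
    (h : ∀ X Z : Π x : M, TangentSpace I x, MDiffAt (T% X) x → MDiffAt (T% Z) x →
      koszul g X Y Z x = g.inner x (L (X x)) (Z x)) : leviCivitaFun g Y x = L := by
  ext v
  refine metric_ext g fun w ↦ ?_
  have h1 := inner_leviCivitaFun g (mdiff_extend v) hY (mdiff_extend w)
  rw [h _ _ (mdiff_extend v) (mdiff_extend w)] at h1
  simpa using h1

theorem isCovariantDerivativeOn_leviCivitaFun :
    IsCovariantDerivativeOn E (leviCivitaFun g) Set.univ where
  add {Y Y' x} hY hY' _ := by
    refine leviCivitaFun_ext g (mdifferentiableAt_add_section hY hY') fun X Z hX hZ ↦ ?_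
    have h1 := mvfderiv_fun_add (mdiff_metric g hY hZ) (mdiff_metric g hY' hZ)
    have h2 := mvfderiv_fun_add (mdiff_metric g hX hY) (mdiff_metric g hX hY')
    simp only [add_apply, map_add, inner_leviCivitaFun g hX hY hZ,
      inner_leviCivitaFun g hX hY' hZ]
    simp [koszul, mlieBracket_add_right hY hY', mlieBracket_add_left hY hY', h1, h2]
    ring
  leibniz {Y f x} hY hf _ := by
    refine leviCivitaFun_ext g (hf.smul_section hY) fun X Z hX hZ ↦ ?_
    have h1 := mvfderiv_fun_mul hf (mdiff_metric g hY hZ)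
    have h2 := mvfderiv_fun_mul hf (mdiff_metric g hX hY)
    simp only [add_apply, map_add, smul_apply, map_smul,
      inner_leviCivitaFun g hX hY hZ, ContinuousLinearMap.smulRight_apply, smul_eq_mul]
    simp [koszul, mlieBracket_smul_right hf hY, mlieBracket_smul_left hf hY, h1, h2]
    rw [g.symm x (Y x) (X x)]
    ring

/-- The Levi-Civita connection of a Riemannian metric, given by Koszul's formula.
`leviCivita g Y x (X x)` is `(∇_X Y)(x)`. -/
def leviCivita : CovariantDerivative I E (TangentSpace I : M → Type _) :=
  ⟨leviCivitaFun g, isCovariantDerivativeOn_leviCivitaFun g⟩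

/-- The connection is torsion free. -/
theorem leviCivita_torsion : (leviCivita g).torsion = 0 := by
  rw [CovariantDerivative.torsion_eq_zero_iff]
  intro X Y x hX hY
  refine metric_ext g fun w ↦ ?_
  have h1 := inner_leviCivitaFun g hX hY (mdiff_extend w)
  have h2 := inner_leviCivitaFun g hY hX (mdiff_extend w)
  simp only [FiberBundle.extend_apply_self] at h1 h2
  change g.inner x (leviCivitaFun g Y x (X x) - leviCivitaFun g X x (Y x)) w = _
  simp only [map_sub, sub_apply, h1, h2, koszul]
  have e : (fun y ↦ g.inner y (X y) (Y y)) = fun y ↦ g.inner y (Y y) (X y) :=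
    funext fun y ↦ g.symm y _ _
  rw [e, mlieBracket_swap_apply (V := Y) (W := X)]
  simp
  ring

/-- The connection is compatible with the metric. -/
theorem leviCivita_metric {X Y Z : Π x : M, TangentSpace I x} (hX : MDiffAt (T% X) x)
    (hY : MDiffAt (T% Y) x) (hZ : MDiffAt (T% Z) x) :
    d% (fun y ↦ g.inner y (Y y) (Z y)) x (X x) =
      g.inner x (leviCivita g Y x (X x)) (Z x) + g.inner x (Y x) (leviCivita g Z x (X x)) := by
  have h1 := inner_leviCivitaFun g hX hY hZ
  have h2 := inner_leviCivitaFun g hX hZ hY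
  rw [g.symm x (Y x)]
  change _ = g.inner x (leviCivitaFun g Y x (X x)) (Z x) +
    g.inner x (leviCivitaFun g Z x (X x)) (Y x)
  rw [h1, h2, koszul, koszul]
  have e : (fun y ↦ g.inner y (Z y) (Y y)) = fun y ↦ g.inner y (Y y) (Z y) :=
    funext fun y ↦ g.symm y _ _
  rw [e, mlieBracket_swap_apply (V := Z) (W := Y)]
  simp
  ring

/-- The vector field `∇_X Y`. -/
def nabla (X Y : Π x : M, TangentSpace I x) (x : M) : TangentSpace I x :=
  leviCivita g Y x (X x)

/-- The gradient of a real function. -/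
def grad (f : M → ℝ) (x : M) : TangentSpace I x :=
  sharp g x (d% f x).toLinearMap

/-- The orthogonal complement of a subspace of a tangent space. -/
def orth (x : M) (K : Submodule ℝ (TangentSpace I x)) : Submodule ℝ (TangentSpace I x) :=
  (metricForm g x).orthogonal K

theorem isCompl_orth (x : M) (K : Submodule ℝ (TangentSpace I x)) : IsCompl K (orth g x K) :=
  LinearMap.BilinForm.isCompl_orthogonal_of_restrict_nondegenerate
    (metricForm_isSymm g x).isRefl (metricForm_restrict_nondegenerate g x K)

/-- A smooth distribution: a family of subspaces of the tangent spaces having, near every point,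
a frame of smooth vector fields. -/
def IsSmoothDistribution (D : Π x : M, Submodule ℝ (TangentSpace I x)) : Prop :=
  ∀ x : M, ∃ (k : ℕ) (s : Fin k → Π y : M, TangentSpace I y), ∃ u ∈ nhds x,
    (∀ i, ContMDiffOn I I.tangent ∞ (T% (s i)) u) ∧
    ∀ y ∈ u, LinearIndependent ℝ (fun i ↦ s i y) ∧
      Submodule.span ℝ (Set.range fun i ↦ s i y) = D y

/-- A smooth section of a distribution. -/
def IsSection (D : Π x : M, Submodule ℝ (TangentSpace I x)) (X : Π x : M, TangentSpace I x) :
    Prop :=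
  ContMDiff I I.tangent ∞ (T% X) ∧ ∀ x, X x ∈ D x

/-- An almost contact metric structure `(φ, ζ, η)` on the Riemannian manifold `(M, g)`.
The `1`-form `η` is smooth because it is dual to `ζ`. -/
structure AlmostContactMetricStructure where
  φ : Π x : M, TangentSpace I x →L[ℝ] TangentSpace I x
  ζ : Π x : M, TangentSpace I x
  η : Π x : M, TangentSpace I x →L[ℝ] ℝ
  contMDiff_φ : ContMDiff I (I.prod 𝓘(ℝ, E →L[ℝ] E)) ∞
    (fun x ↦ TotalSpace.mk' (E →L[ℝ] E)
      (E := fun x : M ↦ TangentSpace I x →L[ℝ] TangentSpace I x) x (φ x))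
  contMDiff_ζ : ContMDiff I I.tangent ∞ (T% ζ)
  φ_φ : ∀ x v, φ x (φ x v) = -v + η x v • ζ x
  φ_ζ : ∀ x, φ x (ζ x) = 0
  η_φ : ∀ x v, η x (φ x v) = 0
  η_ζ : ∀ x, η x (ζ x) = 1
  inner_ζ : ∀ x v, g.inner x v (ζ x) = η x v
  inner_φ_φ : ∀ x v w, g.inner x (φ x v) (φ x w) = g.inner x v w - η x v * η x w
  inner_φ : ∀ x v w, g.inner x (φ x v) w = -g.inner x v (φ x w)

variable {g} in
/-- The Sasakian condition: `(∇_P φ) Q = g(P, Q) ζ - η(Q) P` and `∇_P ζ = -φ P`. -/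
structure AlmostContactMetricStructure.IsSasakian (S : AlmostContactMetricStructure g) : Prop where
  nabla_φ : ∀ P Q : Π x : M, TangentSpace I x,
    ContMDiff I I.tangent ∞ (T% P) → ContMDiff I I.tangent ∞ (T% Q) → ∀ x,
      nabla g P (fun y ↦ S.φ y (Q y)) x - S.φ x (nabla g P Q x)
        = g.inner x (P x) (Q x) • S.ζ x - S.η x (Q x) • P x
  nabla_ζ : ∀ P : Π x : M, TangentSpace I x, ContMDiff I I.tangent ∞ (T% P) → ∀ x,
    nabla g P S.ζ x = -S.φ x (P x)

section Submersion

variable {E' : Type*} [NormedAddCommGroup E'] [NormedSpace ℝ E']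
  {H' : Type*} [TopologicalSpace H'] {J : ModelWithCorners ℝ E' H'}
  {N : Type*} [TopologicalSpace N] [ChartedSpace H' N]

variable (I J) in
/-- The vertical distribution `ker Ψ_*`. -/
def vert (Ψ : M → N) (x : M) : Submodule ℝ (TangentSpace I x) :=
  (mfderiv I J Ψ x).toLinearMap.ker

variable (J) in
/-- The horizontal distribution `(ker Ψ_*)^⊥`. -/
def hor (Ψ : M → N) (x : M) : Submodule ℝ (TangentSpace I x) :=
  orth g x (vert I J Ψ x)

variable (J) in
/-- The orthogonal projection onto `ker Ψ_*`. -/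
def vProj (Ψ : M → N) (x : M) : TangentSpace I x →ₗ[ℝ] TangentSpace I x :=
  Submodule.projection _ _ (isCompl_orth g x (vert I J Ψ x))

variable (J) in
/-- The orthogonal projection onto `(ker Ψ_*)^⊥`. -/
def hProj (Ψ : M → N) (x : M) : TangentSpace I x →ₗ[ℝ] TangentSpace I x :=
  Submodule.projection _ _ (isCompl_orth g x (vert I J Ψ x)).symm

variable (J) in
/-- O'Neill's tensor `T_X Y = 𝓗 ∇_{𝓥X} 𝓥Y + 𝓥 ∇_{𝓥X} 𝓗Y`. -/
def oneillT (Ψ : M → N) (X Y : Π x : M, TangentSpace I x) (x : M) : TangentSpace I x :=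
  hProj g J Ψ x (nabla g (fun y ↦ vProj g J Ψ y (X y)) (fun y ↦ vProj g J Ψ y (Y y)) x)
    + vProj g J Ψ x (nabla g (fun y ↦ vProj g J Ψ y (X y)) (fun y ↦ hProj g J Ψ y (Y y)) x)

variable (J) in
/-- O'Neill's tensor `A_X Y = 𝓗 ∇_{𝓗X} 𝓥Y + 𝓥 ∇_{𝓗X} 𝓗Y`. -/
def oneillA (Ψ : M → N) (X Y : Π x : M, TangentSpace I x) (x : M) : TangentSpace I x :=
  hProj g J Ψ x (nabla g (fun y ↦ hProj g J Ψ y (X y)) (fun y ↦ vProj g J Ψ y (Y y)) x)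
    + vProj g J Ψ x (nabla g (fun y ↦ hProj g J Ψ y (X y)) (fun y ↦ hProj g J Ψ y (Y y)) x)

variable (J) in
/-- The induced connection on the fibers, `∇̂_X Y = 𝓥 ∇_X Y`. -/
def nablaHat (Ψ : M → N) (X Y : Π x : M, TangentSpace I x) (x : M) : TangentSpace I x :=
  vProj g J Ψ x (nabla g X Y x)

variable (J) in
/-- `ker Ψ_*` defines a totally geodesic foliation: `∇_U V` is vertical for all vertical
`U` and `V`. -/
def IsVertTotallyGeodesic (Ψ : M → N) : Prop :=
  ∀ U V : Π x : M, TangentSpace I x, IsSection (vert I J Ψ) U → IsSection (vert I J Ψ) V →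
    ∀ x, nabla g U V x ∈ vert I J Ψ x

section Structure

variable {g} (S : AlmostContactMetricStructure g)

variable (J) in
/-- The vertical part of `φ X`; on vertical `X` this is `ϕ X`, on horizontal `X` it is `α X`. -/
def vertPart (Ψ : M → N) (X : Π x : M, TangentSpace I x) (x : M) : TangentSpace I x :=
  vProj g J Ψ x (S.φ x (X x))

variable (J) in
/-- The horizontal part of `φ X`; on vertical `X` this is `ω X`, on horizontal `X` it is `β X`. -/
def horPart (Ψ : M → N) (X : Π x : M, TangentSpace I x) (x : M) : TangentSpace I x :=
  hProj g J Ψ x (S.φ x (X x))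

variable (g J) in
/-- The orthogonal complement `D₂` of `D₁` in `ker Ψ_*`. -/
def distD₂ (Ψ : M → N) (D₁ : Π x : M, Submodule ℝ (TangentSpace I x)) (x : M) :
    Submodule ℝ (TangentSpace I x) :=
  vert I J Ψ x ⊓ orth g x (D₁ x)

variable (J) in
/-- The orthogonal complement `μ` of `φ D₂` in `(ker Ψ_*)^⊥`. -/
def distMu (Ψ : M → N) (D₁ : Π x : M, Submodule ℝ (TangentSpace I x)) (x : M) :
    Submodule ℝ (TangentSpace I x) :=
  hor g J Ψ x ⊓ orth g x ((distD₂ g J Ψ D₁ x).map (S.φ x).toLinearMap)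

end Structure

variable [IsManifold J ∞ N]
  (h : ContMDiffRiemannianMetric J ∞ E' (fun y : N ↦ TangentSpace J y))

/-- A horizontally conformal submersion `Ψ : (M, g) → (N, h)` with dilation `lam`. -/
structure IsConformalSubmersion (Ψ : M → N) (lam : M → ℝ) : Prop where
  finrank_lt : Module.finrank ℝ E' < Module.finrank ℝ E
  contMDiff : ContMDiff I J ∞ Ψ
  surjective : Function.Surjective Ψ
  surjective_mfderiv : ∀ x, Function.Surjective (mfderiv I J Ψ x)
  lam_pos : ∀ x, 0 < lam x
  conformal : ∀ x, ∀ u ∈ hor g J Ψ x, ∀ v ∈ hor g J Ψ x,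
    h.inner (Ψ x) (mfderiv I J Ψ x u) (mfderiv I J Ψ x v) = lam x ^ 2 * g.inner x u v

variable {g} in
/-- A semi-invariant conformal `ζ^⊥`-Riemannian submersion with dilation `lam` and
invariant distribution `D₁`. -/
structure IsSicSubmersion (S : AlmostContactMetricStructure g) (Ψ : M → N) (lam : M → ℝ)
    (D₁ : Π x : M, Submodule ℝ (TangentSpace I x)) : Prop
    extends IsConformalSubmersion g h Ψ lam where
  ζ_mem : ∀ x, S.ζ x ∈ hor g J Ψ x
  smooth_D₁ : IsSmoothDistribution D₁
  D₁_le : ∀ x, D₁ x ≤ vert I J Ψ x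
  map_D₁ : ∀ x, (D₁ x).map (S.φ x).toLinearMap = D₁ x
  map_D₂ : ∀ x, (distD₂ g J Ψ D₁ x).map (S.φ x).toLinearMap ≤ hor g J Ψ x

variable [FiniteDimensional ℝ E'] in
/-- The connection induced on the pullback bundle `Ψ⁻¹TN` by the Levi-Civita connection of `(N, h)`.
A section `σ` of `Ψ⁻¹TN` near `x` is written `σ = ∑ i, c i • (e i ∘ Ψ)` in the frame `e` of `TN`
given by the trivialization at `Ψ x`, and `∇_v σ = ∑ i, (d(c i) v • e i + c i • ∇_{Ψ_* v} (e i))`.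
The second summand is `∇_{Ψ_* v}` of the field with constant coefficients `c i x` in this frame. -/
def pullbackNabla (Ψ : M → N) (σ : Π x : M, TangentSpace J (Ψ x)) (x : M) :
    TangentSpace I x →L[ℝ] TangentSpace J (Ψ x) :=
  letI t := trivializationAt E' (TangentSpace J : N → Type _) (Ψ x)
  (t.symmL ℝ (Ψ x)) ∘L (d% (fun y : M ↦ (t ⟨Ψ y, σ y⟩).2) x)
    + (leviCivita h (FiberBundle.extend E' (σ x)) (Ψ x)) ∘L (mfderiv I J Ψ x)

end Submersion

end SicSubmersion

end

open SicSubmersion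

/-! ### Vector fields in charts; the Lie bracket as a commutator of derivations. -/

noncomputable section
namespace SicSubmersion

variable {E : Type*} [NormedAddCommGroup E] [NormedSpace ℝ E] [FiniteDimensional ℝ E]
  {M : Type*} [TopologicalSpace M] [ChartedSpace E M] [IsManifold 𝓘(ℝ, E) ∞ M]
  {F : Type*} [NormedAddCommGroup F] [NormedSpace ℝ F]

set_option linter.unusedSectionVars false

/-! Each side of the equivalence forces `D₁ = 0`. Since `∇_U ζ = -φU`, vertical fields satisfy
`g(∇_U V, ζ) = g(φU, V)`. If the fibres are totally geodesic this vanishes, and choosing `V = φU` at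
a point of `D₁` gives `U = 0` there. On the other side, `ζ` is itself a section of `μ`, and
condition 1 with `Z = ζ` collapses to `g(ϕU, V) = 0`, with the same consequence
(`D₁_eq_bot_of_totallyGeodesic`, `D₁_eq_bot_of_pullbackCondition`).

When `D₁ = 0`, `φ` sends vertical vectors to horizontal ones, so `ϕ = 0` and `ω = φ`. Condition 2
becomes `𝓥 φ ∇_U V = 0`: `∇_U V` is orthogonal to `φ(ker Ψ_*)`. In condition 1 the gradient term is
exactly the conformal correction in Koszul's formula for `∇^Ψ` (`inner_pullbackNabla`), and
`g(∇_{φV} Z, φU) = 0` remains. The identity `g(∇_{φV} Z, φU) = -g(∇_U V, Z)` of `inner_nabla_φ` then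
says that condition 1 removes the `μ`-component of `∇_U V`. Together the two conditions remove the
whole horizontal part.

That identity comes from Lie derivatives. The field `ζ` is Killing, unit and horizontal, so the
dilation is constant along the fibres and the horizontal metric is invariant along vertical fields.
The horizontal part of `[ζ, U]` pairs as `2φU`, so commuting the derivatives along `ζ` and `U`
determines the Lie derivative of the horizontal metric along `φU` (`inner_mlieBracket_φ`).

Two analytic inputs are needed: the pullback connection is metric and torsion free, and the
orthogonal projections are smooth, so that vectors extend to global vertical or horizontal sections.
-/

theorem two_le_infty : (2 : WithTop ℕ∞) ≤ ∞ := WithTop.coe_le_coe.2 le_top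

/-- The representative of a vector field in the preferred chart at a point. -/
def chartField (X : Π x : M, TangentSpace 𝓘(ℝ, E) x) (x : M) (z : E) : E :=
  mpullback 𝓘(ℝ, E) 𝓘(ℝ, E) (extChartAt 𝓘(ℝ, E) x).symm X z

/-- The differential of the inverse chart cancels the inverse differential built into `mpullback`,
so derivatives along fields can be computed in the model space. -/
theorem fderiv_comp_extChartAt_symm {k : M → F} {x : M} {z : E}
    (hz : z ∈ (extChartAt 𝓘(ℝ, E) x).target)
    (hk : MDiffAt k ((extChartAt 𝓘(ℝ, E) x).symm z))
    (X : Π x : M, TangentSpace 𝓘(ℝ, E) x) :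
    fderiv ℝ (k ∘ (extChartAt 𝓘(ℝ, E) x).symm) z (chartField X x z)
      = d% k ((extChartAt 𝓘(ℝ, E) x).symm z) (X ((extChartAt 𝓘(ℝ, E) x).symm z)) := by
  have hc : MDiffAt (extChartAt 𝓘(ℝ, E) x).symm z := by
    have := mdifferentiableWithinAt_extChartAt_symm (I := 𝓘(ℝ, E)) hz
    rwa [modelWithCornersSelf_coe, Set.range_id, mdifferentiableWithinAt_univ] at this
  have hinv : (mfderiv 𝓘(ℝ, E) 𝓘(ℝ, E) (extChartAt 𝓘(ℝ, E) x).symm z).IsInvertible := by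
    have := isInvertible_mfderivWithin_extChartAt_symm (I := 𝓘(ℝ, E)) hz
    rwa [modelWithCornersSelf_coe, Set.range_id, mfderivWithin_univ] at this
  rw [← mfderiv_eq_fderiv, mfderiv_comp z hk hc, chartField, mpullback_apply]
  change (mfderiv 𝓘(ℝ, E) 𝓘(ℝ, F) k _) ((mfderiv 𝓘(ℝ, E) 𝓘(ℝ, E) _ z) _) = _
  rw [hinv.self_apply_inverse]
  rfl

theorem mfderiv_extChartAt_mlieBracket (X Y : Π x : M, TangentSpace 𝓘(ℝ, E) x) (x : M) :
    mfderiv 𝓘(ℝ, E) 𝓘(ℝ, E) (extChartAt 𝓘(ℝ, E) x) x (mlieBracket 𝓘(ℝ, E) X Y x) =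
      lieBracket ℝ (chartField X x) (chartField Y x) (extChartAt 𝓘(ℝ, E) x x) := by
  have hinv : (mfderiv 𝓘(ℝ, E) 𝓘(ℝ, E) (extChartAt 𝓘(ℝ, E) x) x).IsInvertible :=
    isInvertible_mfderiv_extChartAt (mem_extChartAt_source x)
  rw [← mlieBracketWithin_univ, mlieBracketWithin_apply]
  refine (hinv.self_apply_inverse _).trans ?_
  simp only [modelWithCornersSelf_coe, Set.range_id, mpullbackWithin_univ, Set.preimage_univ,
    Set.inter_univ]
  exact congrFun (lieBracketWithin_univ (V := chartField X x) (W := chartField Y x)) _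

theorem mfderiv_extChartAt_eq_chartField (X : Π x : M, TangentSpace 𝓘(ℝ, E) x) (x : M) :
    mfderiv 𝓘(ℝ, E) 𝓘(ℝ, E) (extChartAt 𝓘(ℝ, E) x) x (X x)
      = chartField X x (extChartAt 𝓘(ℝ, E) x x) := by
  have hx := mem_extChartAt_source (I := 𝓘(ℝ, E)) x
  have h := fderiv_comp_extChartAt_symm (k := extChartAt 𝓘(ℝ, E) x) (x := x)
    (mem_extChartAt_target x) (by
      rw [extChartAt_to_inv]; exact (contMDiffAt_extChartAt (n := 1)).mdifferentiableAt (by simp)) X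
  have hid : (extChartAt 𝓘(ℝ, E) x ∘ (extChartAt 𝓘(ℝ, E) x).symm)
      =ᶠ[nhds (extChartAt 𝓘(ℝ, E) x x)] id := by
    filter_upwards [extChartAt_target_mem_nhds (I := 𝓘(ℝ, E)) x] with z hz
    exact (extChartAt 𝓘(ℝ, E) x).right_inv hz
  rw [hid.fderiv_eq, fderiv_id, extChartAt_to_inv] at h
  exact h.symm

theorem differentiableAt_chartField {X : Π x : M, TangentSpace 𝓘(ℝ, E) x} {x : M}
    (hX : MDiffAt (T% X) x) : DifferentiableAt ℝ (chartField X x) (extChartAt 𝓘(ℝ, E) x x) := by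
  have : IsManifold 𝓘(ℝ, E) 2 M := IsManifold.of_le (n := ∞) two_le_infty
  rw [← mdifferentiableWithinAt_univ] at hX
  have := hX.differentiableWithinAt_mpullbackWithin_vectorField
  simp only [modelWithCornersSelf_coe, Set.range_id, mpullbackWithin_univ, Set.preimage_univ,
    Set.inter_univ] at this
  exact differentiableWithinAt_univ.1 this

theorem contDiffAt_comp_extChartAt_symm {n : WithTop ℕ∞} {f : M → F} {x : M} (hn : n ≤ ∞)
    (hf : CMDiffAt n f x) :
    ContDiffAt ℝ n (f ∘ (extChartAt 𝓘(ℝ, E) x).symm) (extChartAt 𝓘(ℝ, E) x x) := by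
  rw [← contMDiffAt_iff_contDiffAt]
  have : IsManifold 𝓘(ℝ, E) n M := IsManifold.of_le hn
  have h := contMDiffWithinAt_extChartAt_symm_range (I := 𝓘(ℝ, E)) (n := n) x
    (mem_extChartAt_target x)
  rw [modelWithCornersSelf_coe, Set.range_id, contMDiffWithinAt_univ] at h
  exact ContMDiffAt.comp _ (by rwa [extChartAt_to_inv]) h

theorem mdifferentiableAt_of_comp_extChartAt_symm {k : M → F} {x : M}
    (hk : DifferentiableAt ℝ (k ∘ (extChartAt 𝓘(ℝ, E) x).symm) (extChartAt 𝓘(ℝ, E) x x)) :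
    MDiffAt k x := by
  have h := hk.mdifferentiableAt.comp x
    ((contMDiffAt_extChartAt (I := 𝓘(ℝ, E)) (n := 1)).mdifferentiableAt (by simp))
  refine h.congr_of_eventuallyEq ?_
  filter_upwards [extChartAt_source_mem_nhds (I := 𝓘(ℝ, E)) x] with y hy
  simp [(chartAt E x).left_inv (by simpa using hy)]

theorem eventually_fderiv_comp_extChartAt_symm {f : M → F} {x : M} (hf : CMDiffAt 2 f x)
    (X : Π x : M, TangentSpace 𝓘(ℝ, E) x) :
    (fun z ↦ fderiv ℝ (f ∘ (extChartAt 𝓘(ℝ, E) x).symm) z (chartField X x z))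
      =ᶠ[nhds (extChartAt 𝓘(ℝ, E) x x)]
    ((fun y ↦ d% f y (X y)) ∘ (extChartAt 𝓘(ℝ, E) x).symm) := by
  have : IsManifold 𝓘(ℝ, E) 2 M := IsManifold.of_le (n := ∞) two_le_infty
  have h1 : ∀ᶠ y in nhds x, MDiffAt f y :=
    ((contMDiffAt_iff_contMDiffAt_nhds (by simp)).1 hf).mono
      fun y hy ↦ hy.mdifferentiableAt (by simp)
  have h2 := (continuousAt_extChartAt_symm (I := 𝓘(ℝ, E)) x).eventually
    (p := fun y ↦ MDiffAt f y) (by simpa using h1)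
  filter_upwards [h2, extChartAt_target_mem_nhds (I := 𝓘(ℝ, E)) x] with z h1 hz
  exact fderiv_comp_extChartAt_symm hz h1 X

theorem mdifferentiableAt_mvfderiv_apply {f : M → F} {x : M} (hf : CMDiffAt 2 f x)
    {X : Π x : M, TangentSpace 𝓘(ℝ, E) x} (hX : MDiffAt (T% X) x) :
    MDiffAt (fun y ↦ d% f y (X y)) x := by
  have hf' := contDiffAt_comp_extChartAt_symm two_le_infty hf
  apply mdifferentiableAt_of_comp_extChartAt_symm
  refine DifferentiableAt.congr_of_eventuallyEq ?_
    (eventually_fderiv_comp_extChartAt_symm hf X).symm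
  exact ((hf'.fderiv_right (m := 1) (by norm_num)).differentiableAt (by simp)).clm_apply
    (differentiableAt_chartField hX)

/-- Differentiation along a Lie bracket is the commutator of the differentiations. -/
theorem mvfderiv_mlieBracket {f : M → F} {x : M} (hf : CMDiffAt 2 f x)
    {X Y : Π x : M, TangentSpace 𝓘(ℝ, E) x} (hX : MDiffAt (T% X) x) (hY : MDiffAt (T% Y) x) :
    d% f x (mlieBracket 𝓘(ℝ, E) X Y x) =
      d% (fun y ↦ d% f y (Y y)) x (X x) - d% (fun y ↦ d% f y (X y)) x (Y x) := by
  have hf' := contDiffAt_comp_extChartAt_symm two_le_infty hf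
  have hz := mem_extChartAt_target (I := 𝓘(ℝ, E)) x
  -- Every term moves to the chart, where the claim is the symmetry of the second derivative of a
  -- `C²` map.
  have key (k : M → F) (hk : MDiffAt k x) (Z : Π x : M, TangentSpace 𝓘(ℝ, E) x) :
      d% k x (Z x) = fderiv ℝ (k ∘ (extChartAt 𝓘(ℝ, E) x).symm) (extChartAt 𝓘(ℝ, E) x x)
        (mfderiv 𝓘(ℝ, E) 𝓘(ℝ, E) (extChartAt 𝓘(ℝ, E) x) x (Z x)) := by
    rw [mfderiv_extChartAt_eq_chartField, fderiv_comp_extChartAt_symm hz (by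
      rwa [extChartAt_to_inv]), extChartAt_to_inv]
  rw [key f (hf.mdifferentiableAt (by simp)), mfderiv_extChartAt_mlieBracket,
    fderiv_apply_lieBracket hf' (by simp) (differentiableAt_chartField hY)
      (differentiableAt_chartField hX), key _ (mdifferentiableAt_mvfderiv_apply hf hY),
    key _ (mdifferentiableAt_mvfderiv_apply hf hX), mfderiv_extChartAt_eq_chartField,
    mfderiv_extChartAt_eq_chartField, (eventually_fderiv_comp_extChartAt_symm hf X).fderiv_eq,
    (eventually_fderiv_comp_extChartAt_symm hf Y).fderiv_eq]

/-- Every tangent vector is the value of a globally smooth vector field. -/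
theorem exists_contMDiff_vectorField_apply_eq [T2Space M] {x : M} (v : TangentSpace 𝓘(ℝ, E) x) :
    ∃ X : Π x : M, TangentSpace 𝓘(ℝ, E) x, CMDiff ∞ (T% X) ∧ X x = v := by
  obtain ⟨s, hs, hs'⟩ := FiberBundle.exists_contMDiffOn_extend (I := 𝓘(ℝ, E)) (k := ∞) E v
  obtain ⟨u, hus, hu, hxu⟩ := mem_nhds_iff.1 hs
  obtain ⟨f, -, hf⟩ := (SmoothBumpFunction.nhds_basis_tsupport (I := 𝓘(ℝ, E)) x).mem_iff.1
    (hu.mem_nhds hxu)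
  refine ⟨(f : M → ℝ) • FiberBundle.extend E v, ?_, ?_⟩
  · exact f.contMDiff.contMDiffOn.smul_section_of_tsupport hu hf (hs'.mono hus)
  · simp

end SicSubmersion
end

/-! ### Product rule; the metric and constant fields in trivializations. -/

noncomputable section
namespace SicSubmersion

set_option linter.unusedSectionVars false

section ProductRule

variable {E : Type*} [NormedAddCommGroup E] [NormedSpace ℝ E]
  {M : Type*} [TopologicalSpace M] [ChartedSpace E M]
  {F : Type*} [NormedAddCommGroup F] [NormedSpace ℝ F]
  {G : Type*} [NormedAddCommGroup G] [NormedSpace ℝ G]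

theorem mvfderiv_clm_apply {L : M → F →L[ℝ] G} {u : M → F} {x : M}
    (hL : MDiffAt L x) (hu : MDiffAt u x) (v : TangentSpace 𝓘(ℝ, E) x) :
    d% (fun y ↦ L y (u y)) x v = d% L x v (u x) + L x (d% u x v) := by
  have hLu : MDiffAt (fun y ↦ L y (u y)) x := hL.clm_apply hu
  rw [hLu.mvfderiv, hL.mvfderiv, hu.mvfderiv]
  have h1 := hL.differentiableWithinAt_writtenInExtChartAt
  have h2 := hu.differentiableWithinAt_writtenInExtChartAt
  have h3 := fderivWithin_clm_apply (x := extChartAt 𝓘(ℝ, E) x x)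
    𝓘(ℝ, E).uniqueDiffWithinAt_image h1 h2
  have h4 := fun w : E ↦ congrArg (fun T : E →L[ℝ] G ↦ T w) h3
  simp only [add_apply, ContinuousLinearMap.comp_apply, ContinuousLinearMap.flip_apply] at h4
  have hLx : writtenInExtChartAt 𝓘(ℝ, E) 𝓘(ℝ, F →L[ℝ] G) x L (extChartAt 𝓘(ℝ, E) x x) = L x := by
    change L ((extChartAt 𝓘(ℝ, E) x).symm (extChartAt 𝓘(ℝ, E) x x)) = L x
    rw [extChartAt_to_inv]
  have hux : writtenInExtChartAt 𝓘(ℝ, E) 𝓘(ℝ, F) x u (extChartAt 𝓘(ℝ, E) x x) = u x := by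
    change u ((extChartAt 𝓘(ℝ, E) x).symm (extChartAt 𝓘(ℝ, E) x x)) = u x
    rw [extChartAt_to_inv]
  rw [hLx, hux] at h4
  exact (h4 v).trans (add_comm _ _)

end ProductRule

section Coordinates

variable {E : Type*} [NormedAddCommGroup E] [NormedSpace ℝ E] [FiniteDimensional ℝ E]
  {M : Type*} [TopologicalSpace M] [ChartedSpace E M] [IsManifold 𝓘(ℝ, E) ∞ M]
  (g : ContMDiffRiemannianMetric 𝓘(ℝ, E) ∞ E (fun x : M ↦ TangentSpace 𝓘(ℝ, E) x))

/-- The inverse, over `q`, of the trivialization of the tangent bundle at `p`. -/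
def coordSymm (p q : M) : E →L[ℝ] TangentSpace 𝓘(ℝ, E) q :=
  (trivializationAt E (TangentSpace 𝓘(ℝ, E) : M → Type _) p).symmL ℝ q

/-- The metric at `q`, read in the trivialization of the tangent bundle at `p`. -/
def coordMetric (p q : M) : E →L[ℝ] E →L[ℝ] ℝ :=
  ContinuousLinearMap.inCoordinates E (fun x : M ↦ TangentSpace 𝓘(ℝ, E) x) (E →L[ℝ] ℝ)
    (fun x : M ↦ TangentSpace 𝓘(ℝ, E) x →L[ℝ] Bundle.Trivial M ℝ x) p q p q (g.inner q)

theorem contMDiffAt_coordMetric (p : M) : CMDiffAt ∞ (coordMetric g p) p :=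
  ((contMDiffAt_hom_bundle _).1 (g.contMDiff p)).2

theorem coordMetric_apply {p q : M} (hq : q ∈ (chartAt E p).source) (a b : E) :
    coordMetric g p q a b = g.inner q (coordSymm p q a) (coordSymm p q b) := by
  have h1 : q ∈ (trivializationAt E (TangentSpace 𝓘(ℝ, E) : M → Type _) p).baseSet := hq
  have h2 : q ∈ (trivializationAt (E →L[ℝ] ℝ)
      (fun x : M ↦ TangentSpace 𝓘(ℝ, E) x →L[ℝ] Bundle.Trivial M ℝ x) p).baseSet := ⟨hq, trivial⟩
  rw [coordMetric, ContinuousLinearMap.inCoordinates_eq h1 h2]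
  simp [coordSymm, hom_trivializationAt_apply, ContinuousLinearMap.inCoordinates]
  rw [Trivialization.symmL_apply _ h1, Trivialization.symmL_apply _ h1]

theorem extend_eq_coordSymm {x q : M} (hq : q ∈ (chartAt E x).source) (v : TangentSpace 𝓘(ℝ, E) x) :
    (FiberBundle.extend E v : Π y : M, TangentSpace 𝓘(ℝ, E) y) q =
      coordSymm x q (trivializationAt E (TangentSpace 𝓘(ℝ, E) : M → Type _) x ⟨x, v⟩).2 := by
  rw [coordSymm, Trivialization.symmL_apply _ hq]
  rfl

theorem trivializationAt_snd_eq_mfderiv {p q : M} (hq : q ∈ (chartAt E p).source)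
    (w : TangentSpace 𝓘(ℝ, E) q) :
    (trivializationAt E (TangentSpace 𝓘(ℝ, E) : M → Type _) p ⟨q, w⟩).2 =
      mfderiv 𝓘(ℝ, E) 𝓘(ℝ, E) (extChartAt 𝓘(ℝ, E) p) q w := by
  have : IsManifold 𝓘(ℝ, E) 1 M := IsManifold.of_le (n := ∞) (WithTop.coe_le_coe.2 le_top)
  refine Eq.trans ?_ (congrArg (fun L : TangentSpace 𝓘(ℝ, E) q →L[ℝ] E ↦ L w)
    (TangentBundle.continuousLinearMapAt_trivializationAt hq))
  rw [Trivialization.continuousLinearMapAt_apply, Trivialization.linearMapAt_apply]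
  exact (if_pos hq).symm

/-- The trivialization at `x` is the differential of the chart at `x`, so extending a vector with
constant coefficients gives a constant field in that chart. Hence such extensions commute. -/
theorem chartField_extend_eventuallyEq {x : M} (v : TangentSpace 𝓘(ℝ, E) x) :
    chartField (FiberBundle.extend E v : Π y : M, TangentSpace 𝓘(ℝ, E) y) x
      =ᶠ[nhds (extChartAt 𝓘(ℝ, E) x x)]
    fun _ ↦ (trivializationAt E (TangentSpace 𝓘(ℝ, E) : M → Type _) x ⟨x, v⟩).2 := by
  have : IsManifold 𝓘(ℝ, E) 1 M := IsManifold.of_le (n := ∞) (WithTop.coe_le_coe.2 le_top)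
  filter_upwards [extChartAt_target_mem_nhds (I := 𝓘(ℝ, E)) x] with z hz
  have hz' : (extChartAt 𝓘(ℝ, E) x).symm z ∈ (chartAt E x).source := by
    simpa using (extChartAt 𝓘(ℝ, E) x).map_target hz
  have hinv : (mfderiv 𝓘(ℝ, E) 𝓘(ℝ, E) (extChartAt 𝓘(ℝ, E) x).symm z).IsInvertible := by
    have := isInvertible_mfderivWithin_extChartAt_symm (I := 𝓘(ℝ, E)) hz
    rwa [modelWithCornersSelf_coe, Set.range_id, mfderivWithin_univ] at this
  have hs := TangentBundle.symmL_trivializationAt (I := 𝓘(ℝ, E)) hz'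
  rw [(extChartAt 𝓘(ℝ, E) x).right_inv hz, modelWithCornersSelf_coe, Set.range_id,
    mfderivWithin_univ] at hs
  rw [chartField, mpullback_apply, extend_eq_coordSymm hz']
  refine Eq.trans (congrArg _ ?_) (hinv.inverse_apply_self _)
  exact congrArg (fun L : E →L[ℝ] TangentSpace 𝓘(ℝ, E) ((extChartAt 𝓘(ℝ, E) x).symm z) ↦
    L (trivializationAt E (TangentSpace 𝓘(ℝ, E) : M → Type _) x ⟨x, v⟩).2) hs

theorem mlieBracket_extend {x : M} (v w : TangentSpace 𝓘(ℝ, E) x) :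
    mlieBracket 𝓘(ℝ, E) (FiberBundle.extend E v) (FiberBundle.extend E w) x = 0 := by
  have hinv : (mfderiv 𝓘(ℝ, E) 𝓘(ℝ, E) (extChartAt 𝓘(ℝ, E) x) x).IsInvertible :=
    isInvertible_mfderiv_extChartAt (mem_extChartAt_source x)
  apply hinv.injective
  rw [mfderiv_extChartAt_mlieBracket, map_zero,
    (chartField_extend_eventuallyEq v).lieBracket_vectorField_eq
      (chartField_extend_eventuallyEq w)]
  simp [lieBracket]
  rfl

end Coordinates

/-! ### The pullback connection: torsion and compatibility with the metric. -/

section Pullback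

variable {E : Type*} [NormedAddCommGroup E] [NormedSpace ℝ E] [FiniteDimensional ℝ E]
  {M : Type*} [TopologicalSpace M] [ChartedSpace E M] [IsManifold 𝓘(ℝ, E) ∞ M]
  {E' : Type*} [NormedAddCommGroup E'] [NormedSpace ℝ E'] [FiniteDimensional ℝ E']
  {N : Type*} [TopologicalSpace N] [ChartedSpace E' N] [IsManifold 𝓘(ℝ, E') ∞ N]
  (h : ContMDiffRiemannianMetric 𝓘(ℝ, E') ∞ E' (fun y : N ↦ TangentSpace 𝓘(ℝ, E') y))
  {Ψ : M → N} {x : M}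

/-- The coordinates, in the trivialization of `TN` at `Ψ x`, of a section of `Ψ⁻¹TN`. -/
def pullbackCoord (Ψ : M → N) (σ : Π x : M, TangentSpace 𝓘(ℝ, E') (Ψ x)) (x y : M) : E' :=
  (trivializationAt E' (TangentSpace 𝓘(ℝ, E') : N → Type _) (Ψ x) ⟨Ψ y, σ y⟩).2

theorem pullbackNabla_apply (σ : Π x : M, TangentSpace 𝓘(ℝ, E') (Ψ x))
    (v : TangentSpace 𝓘(ℝ, E) x) :
    pullbackNabla h Ψ σ x v =
      coordSymm (Ψ x) (Ψ x) (d% (pullbackCoord Ψ σ x) x v)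
      + leviCivita h (FiberBundle.extend E' (σ x)) (Ψ x) (mfderiv 𝓘(ℝ, E) 𝓘(ℝ, E') Ψ x v) := rfl

theorem symm_pullbackCoord {y : M} (hy : Ψ y ∈ (chartAt E' (Ψ x)).source)
    (σ : Π x : M, TangentSpace 𝓘(ℝ, E') (Ψ x)) :
    coordSymm (Ψ x) (Ψ y) (pullbackCoord Ψ σ x y) = σ y := by
  rw [coordSymm, Trivialization.symmL_apply _ hy]
  exact (trivializationAt E' (TangentSpace 𝓘(ℝ, E') : N → Type _) (Ψ x)).symm_apply_apply_mk hy (σ y)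

/-- By the chain rule `Ψ_* X` turns into the derivative along `X` of one vector-valued function, to
which the commutator formula for the bracket applies. -/
theorem pullbackCoord_mfderiv (hΨ : CMDiff ∞ Ψ) {y : M}
    (hy : Ψ y ∈ (chartAt E' (Ψ x)).source) (X : Π x : M, TangentSpace 𝓘(ℝ, E) x) :
    pullbackCoord Ψ (fun y ↦ mfderiv 𝓘(ℝ, E) 𝓘(ℝ, E') Ψ y (X y)) x y =
      d% (extChartAt 𝓘(ℝ, E') (Ψ x) ∘ Ψ) y (X y) := by
  have hc : MDiffAt (extChartAt 𝓘(ℝ, E') (Ψ x)) (Ψ y) :=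
    (contMDiffAt_extChartAt' (n := 1) hy).mdifferentiableAt (by simp)
  rw [pullbackCoord, trivializationAt_snd_eq_mfderiv hy, mvfderiv,
    mfderiv_comp y hc ((hΨ y).mdifferentiableAt (by simp))]
  rfl

theorem eventually_mem_chart_source (hΨ : CMDiff ∞ Ψ) (x : M) :
    ∀ᶠ y in nhds x, Ψ y ∈ (chartAt E' (Ψ x)).source :=
  hΨ.continuous.continuousAt.eventually
    ((chartAt E' (Ψ x)).open_source.mem_nhds (mem_chart_source E' (Ψ x)))

theorem pullbackCoord_mfderiv_eventuallyEq (hΨ : CMDiff ∞ Ψ) (X : Π x : M, TangentSpace 𝓘(ℝ, E) x) :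
    pullbackCoord Ψ (fun y ↦ mfderiv 𝓘(ℝ, E) 𝓘(ℝ, E') Ψ y (X y)) x =ᶠ[nhds x]
      fun y ↦ d% (extChartAt 𝓘(ℝ, E') (Ψ x) ∘ Ψ) y (X y) :=
  (eventually_mem_chart_source hΨ x).mono fun _ hy ↦ pullbackCoord_mfderiv hΨ hy X

theorem contMDiffAt_extChartAt_comp (hΨ : CMDiff ∞ Ψ) (x : M) :
    CMDiffAt 2 (extChartAt 𝓘(ℝ, E') (Ψ x) ∘ Ψ) x :=
  (contMDiffAt_extChartAt.comp x (hΨ x)).of_le two_le_infty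

theorem mdiff_pullbackCoord_mfderiv (hΨ : CMDiff ∞ Ψ) {X : Π x : M, TangentSpace 𝓘(ℝ, E) x}
    (hX : MDiffAt (T% X) x) :
    MDiffAt (pullbackCoord Ψ (fun y ↦ mfderiv 𝓘(ℝ, E) 𝓘(ℝ, E') Ψ y (X y)) x) x :=
  (mdifferentiableAt_mvfderiv_apply (contMDiffAt_extChartAt_comp hΨ x) hX).congr_of_eventuallyEq
    (pullbackCoord_mfderiv_eventuallyEq hΨ X)

/-- The pullback connection is torsion free. -/
theorem pullbackNabla_mfderiv_sub (hΨ : CMDiff ∞ Ψ) {X Y : Π x : M, TangentSpace 𝓘(ℝ, E) x}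
    (hX : MDiffAt (T% X) x) (hY : MDiffAt (T% Y) x) :
    pullbackNabla h Ψ (fun y ↦ mfderiv 𝓘(ℝ, E) 𝓘(ℝ, E') Ψ y (Y y)) x (X x)
      - pullbackNabla h Ψ (fun y ↦ mfderiv 𝓘(ℝ, E) 𝓘(ℝ, E') Ψ y (X y)) x (Y x)
      = mfderiv 𝓘(ℝ, E) 𝓘(ℝ, E') Ψ x (mlieBracket 𝓘(ℝ, E) X Y x) := by
  have h1 := mvfderiv_mlieBracket (contMDiffAt_extChartAt_comp hΨ x) hX hY
  have hx := mem_chart_source E' (Ψ x)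
  -- Constant-coefficient fields on `N` commute, so the two `∇^N` contributions are equal and cancel
  -- in the difference.
  have h2 := (CovariantDerivative.torsion_eq_zero_iff _).1 (leviCivita_torsion h)
    (mdiff_extend (mfderiv 𝓘(ℝ, E) 𝓘(ℝ, E') Ψ x (X x)))
    (mdiff_extend (mfderiv 𝓘(ℝ, E) 𝓘(ℝ, E') Ψ x (Y x)))
  rw [mlieBracket_extend] at h2
  simp only [FiberBundle.extend_apply_self] at h2
  rw [← pullbackCoord_mfderiv hΨ hx (mlieBracket 𝓘(ℝ, E) X Y)] at h1
  have e (Z : Π x : M, TangentSpace 𝓘(ℝ, E) x) :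
      d% (pullbackCoord Ψ (fun y ↦ mfderiv 𝓘(ℝ, E) 𝓘(ℝ, E') Ψ y (Z y)) x) x
        = d% (fun y ↦ d% (extChartAt 𝓘(ℝ, E') (Ψ x) ∘ Ψ) y (Z y)) x := by
    ext v
    exact congrArg (fun L : E →L[ℝ] E' ↦ L v)
      (pullbackCoord_mfderiv_eventuallyEq (x := x) hΨ Z).mfderiv_eq
  rw [pullbackNabla_apply, pullbackNabla_apply, e X, e Y, add_sub_add_comm, h2, add_zero,
    ← map_sub, ← h1]
  exact symm_pullbackCoord hx (fun y ↦ mfderiv 𝓘(ℝ, E) 𝓘(ℝ, E') Ψ y (mlieBracket 𝓘(ℝ, E) X Y y))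

/-- The metric of `N` pulled back to `M`, in the trivialization of `TN` at `Ψ x`. -/
theorem inner_eventuallyEq_coordMetric (hΨ : CMDiff ∞ Ψ)
    (σ τ : Π x : M, TangentSpace 𝓘(ℝ, E') (Ψ x)) :
    (fun y ↦ h.inner (Ψ y) (σ y) (τ y)) =ᶠ[nhds x]
      fun y ↦ coordMetric h (Ψ x) (Ψ y) (pullbackCoord Ψ σ x y) (pullbackCoord Ψ τ x y) := by
  filter_upwards [eventually_mem_chart_source hΨ x] with y hy
  rw [coordMetric_apply h hy, symm_pullbackCoord hy, symm_pullbackCoord hy]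

theorem mdiff_coordMetric_comp (hΨ : CMDiff ∞ Ψ) (x : M) :
    MDiffAt (fun y ↦ coordMetric h (Ψ x) (Ψ y)) x :=
  ((contMDiffAt_coordMetric h (Ψ x)).mdifferentiableAt (by simp)).comp x
    ((hΨ x).mdifferentiableAt (by simp))

theorem mdiff_inner_pullback (hΨ : CMDiff ∞ Ψ) {σ τ : Π x : M, TangentSpace 𝓘(ℝ, E') (Ψ x)}
    (hσ : MDiffAt (pullbackCoord Ψ σ x) x) (hτ : MDiffAt (pullbackCoord Ψ τ x) x) :
    MDiffAt (fun y ↦ h.inner (Ψ y) (σ y) (τ y)) x :=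
  (((mdiff_coordMetric_comp h hΨ x).clm_apply hσ).clm_apply hτ).congr_of_eventuallyEq
    (inner_eventuallyEq_coordMetric h hΨ σ τ)

/-- The pullback connection is compatible with the metric. -/
theorem mvfderiv_inner_pullback (hΨ : CMDiff ∞ Ψ) {σ τ : Π x : M, TangentSpace 𝓘(ℝ, E') (Ψ x)}
    (hσ : MDiffAt (pullbackCoord Ψ σ x) x) (hτ : MDiffAt (pullbackCoord Ψ τ x) x)
    (v : TangentSpace 𝓘(ℝ, E) x) :
    d% (fun y ↦ h.inner (Ψ y) (σ y) (τ y)) x v =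
      h.inner (Ψ x) (pullbackNabla h Ψ σ x v) (τ x)
        + h.inner (Ψ x) (σ x) (pullbackNabla h Ψ τ x v) := by
  set B : M → E' →L[ℝ] E' →L[ℝ] ℝ := fun y ↦ coordMetric h (Ψ x) (Ψ y) with hBdef
  have hx := mem_chart_source E' (Ψ x)
  have hΨx : MDiffAt Ψ x := (hΨ x).mdifferentiableAt (by simp)
  have hcm : MDiffAt (coordMetric h (Ψ x)) (Ψ x) :=
    (contMDiffAt_coordMetric h (Ψ x)).mdifferentiableAt (by simp)
  have hB : MDiffAt B x := mdiff_coordMetric_comp h hΨ x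
  have hloc := inner_eventuallyEq_coordMetric (x := x) h hΨ σ τ
  have e1 : d% (fun y ↦ h.inner (Ψ y) (σ y) (τ y)) x v =
      d% (fun y ↦ B y (pullbackCoord Ψ σ x y) (pullbackCoord Ψ τ x y)) x v :=
    congrArg (fun L : E →L[ℝ] ℝ ↦ L v) hloc.mfderiv_eq
  rw [e1, mvfderiv_clm_apply (hB.clm_apply hσ) hτ, mvfderiv_clm_apply hB hσ]
  set w := mfderiv 𝓘(ℝ, E) 𝓘(ℝ, E') Ψ x v with hw
  set a := pullbackCoord Ψ σ x x with ha
  set b := pullbackCoord Ψ τ x x with hb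
  -- With the coefficients frozen, the derivative of the metric coefficients descends to `N`. There
  -- it differentiates the inner product of two constant-coefficient fields, and metric
  -- compatibility on `N` applies.
  have e2 : d% B x v a b = d% (fun q ↦ coordMetric h (Ψ x) q a b) (Ψ x) w := by
    have hc : MDiffAt (fun q ↦ coordMetric h (Ψ x) q a b) (Ψ x) :=
      (hcm.clm_apply mdifferentiableAt_const).clm_apply mdifferentiableAt_const
    rw [hw, ← mvfderiv_comp_apply x hc hΨx]
    change _ = d% (fun y ↦ B y a b) x v
    rw [mvfderiv_clm_apply (hB.clm_apply mdifferentiableAt_const) mdifferentiableAt_const,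
      mvfderiv_clm_apply hB mdifferentiableAt_const, mvfderiv_const, mvfderiv_const]
    simp
  have e3 : d% (fun q ↦ coordMetric h (Ψ x) q a b) (Ψ x) w =
      d% (fun q ↦ h.inner q (FiberBundle.extend E' (σ x) q) (FiberBundle.extend E' (τ x) q))
        (Ψ x) w := by
    refine congrArg (fun L : E' →L[ℝ] ℝ ↦ L w) (Filter.EventuallyEq.mfderiv_eq ?_)
    filter_upwards [(chartAt E' (Ψ x)).open_source.mem_nhds hx] with q hq
    rw [coordMetric_apply h hq, extend_eq_coordSymm hq, extend_eq_coordSymm hq]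
    rfl
  have e4 := leviCivita_metric h (mdiff_extend w) (mdiff_extend (σ x)) (mdiff_extend (τ x))
  simp only [FiberBundle.extend_apply_self] at e4
  rw [add_apply, e2, e3, e4, pullbackNabla_apply, pullbackNabla_apply, hBdef]
  simp only [coordMetric_apply h hx, ha, hb, symm_pullbackCoord hx, map_add, add_apply, ← hw]
  ring

end Pullback

end SicSubmersion
end

/-! ### A saddle-point system whose solution is the horizontal projection. -/

noncomputable section
namespace SicSubmersion

set_option linter.unusedSectionVars false

section Block

variable {E C D F : Type*} [NormedAddCommGroup E] [NormedSpace ℝ E] [CompleteSpace E]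
  [NormedAddCommGroup C] [NormedSpace ℝ C] [NormedAddCommGroup D] [NormedSpace ℝ D]
  [CompleteSpace D] [NormedAddCommGroup F] [NormedSpace ℝ F]

/-- The block operator `(a, ξ) ↦ (A a - B ξ, P a)`. -/
def blockOp (A : E →L[ℝ] C) (B : D →L[ℝ] C) (P : E →L[ℝ] F) : E × D →L[ℝ] C × F :=
  .inl ℝ C F ∘L (A ∘L .fst ℝ E D - B ∘L .snd ℝ E D) + .inr ℝ C F ∘L P ∘L .fst ℝ E D

theorem blockOp_apply (A : E →L[ℝ] C) (B : D →L[ℝ] C) (P : E →L[ℝ] F) (a : E) (ξ : D) :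
    blockOp A B P (a, ξ) = (A a - B ξ, P a) := by
  simp [blockOp]

/-- The block operator depends smoothly on its blocks, and inversion is smooth at invertible
operators. The block `B`, later `ξ ↦ ξ ∘ P`, is treated as an independent parameter. -/
theorem contDiffAt_blockOp_inverse_fst {A : E →L[ℝ] C} {B : D →L[ℝ] C} {P : E →L[ℝ] F} {v : E}
    (hinv : (blockOp A B P).IsInvertible) :
    ContDiffAt ℝ ∞
      (fun p : (E →L[ℝ] C) × (D →L[ℝ] C) × (E →L[ℝ] F) × E ↦
        ((blockOp p.1 p.2.1 p.2.2.1).inverse (0, p.2.2.1 p.2.2.2)).1) (A, B, P, v) := by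
  have hB : ContDiff ℝ ∞ fun p : (E →L[ℝ] C) × (D →L[ℝ] C) × (E →L[ℝ] F) × E ↦
      blockOp p.1 p.2.1 p.2.2.1 :=
    (contDiff_const.clm_comp ((contDiff_fst.clm_comp contDiff_const).sub
      (contDiff_snd.fst.clm_comp contDiff_const))).add
      (contDiff_const.clm_comp (contDiff_snd.snd.fst.clm_comp contDiff_const))
  have hI : ContDiffAt ℝ ∞ (fun p : (E →L[ℝ] C) × (D →L[ℝ] C) × (E →L[ℝ] F) × E ↦
      (blockOp p.1 p.2.1 p.2.2.1).inverse) (A, B, P, v) :=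
    ContDiffAt.comp (g := ContinuousLinearMap.inverse)
      (f := fun p : (E →L[ℝ] C) × (D →L[ℝ] C) × (E →L[ℝ] F) × E ↦ blockOp p.1 p.2.1 p.2.2.1)
      (A, B, P, v) hinv.contDiffAt_map_inverse hB.contDiffAt
  exact (hI.clm_apply (contDiffAt_const.prodMk
    (contDiff_snd.snd.fst.clm_apply contDiff_snd.snd.snd).contDiffAt)).fst

theorem contDiff_compL_flip :
    ContDiff ℝ ∞ fun P : E →L[ℝ] F ↦ (ContinuousLinearMap.compL ℝ E F C).flip P :=
  ContinuousLinearMap.contDiff _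

end Block

section Saddle

variable {E : Type*} [NormedAddCommGroup E] [NormedSpace ℝ E] [FiniteDimensional ℝ E]
  {E' : Type*} [NormedAddCommGroup E'] [NormedSpace ℝ E'] [FiniteDimensional ℝ E']

/-- The operator `(a, ξ) ↦ (G a - ξ ∘ P, P a)`; its inverse computes the `G`-orthogonal
projection onto the orthogonal complement of `ker P`. -/
def saddle (G : E →L[ℝ] E →L[ℝ] ℝ) (P : E →L[ℝ] E') :
    E × (E' →L[ℝ] ℝ) →L[ℝ] (E →L[ℝ] ℝ) × E' :=
  blockOp G ((ContinuousLinearMap.compL ℝ E E' ℝ).flip P) P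

theorem saddle_apply (G : E →L[ℝ] E →L[ℝ] ℝ) (P : E →L[ℝ] E') (a : E) (ξ : E' →L[ℝ] ℝ) :
    saddle G P (a, ξ) = (G a - ξ ∘L P, P a) :=
  blockOp_apply _ _ _ _ _

theorem finrank_continuousDual (V : Type*) [NormedAddCommGroup V] [NormedSpace ℝ V]
    [FiniteDimensional ℝ V] : Module.finrank ℝ (V →L[ℝ] ℝ) = Module.finrank ℝ V := by
  rw [← (LinearMap.toContinuousLinearMap : (V →ₗ[ℝ] ℝ) ≃ₗ[ℝ] (V →L[ℝ] ℝ)).finrank_eq]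
  exact Subspace.dual_finrank_eq

/-- On the kernel `P a = 0`, hence `G a a = ξ (P a) = 0` and `a = 0`; then `ξ ∘ P = 0` and
surjectivity of `P` gives `ξ = 0`. Source and target have equal dimension. -/
theorem saddle_isInvertible {G : E →L[ℝ] E →L[ℝ] ℝ} {P : E →L[ℝ] E'}
    (hG : ∀ a, G a a = 0 → a = 0) (hP : Function.Surjective P) : (saddle G P).IsInvertible := by
  have hinj : Function.Injective (saddle G P).toLinearMap := by
    rw [← LinearMap.ker_eq_bot, LinearMap.ker_eq_bot']
    rintro ⟨a, ξ⟩ h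
    have h' := (saddle_apply G P a ξ).symm.trans h
    rw [Prod.mk_eq_zero] at h'
    obtain ⟨h1, h2⟩ := h'
    have ha : a = 0 := hG a (by
      have := congrArg (fun l : E →L[ℝ] ℝ ↦ l a) h1
      simpa [h2] using this)
    subst ha
    have hξ : ξ = 0 := by
      ext b
      obtain ⟨c, rfl⟩ := hP b
      have := congrArg (fun l : E →L[ℝ] ℝ ↦ l c) h1
      simpa using this
    rw [hξ]; rfl
  have hdim : Module.finrank ℝ (E × (E' →L[ℝ] ℝ)) = Module.finrank ℝ ((E →L[ℝ] ℝ) × E') := by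
    rw [Module.finrank_prod, Module.finrank_prod, finrank_continuousDual, finrank_continuousDual]
  exact ⟨(LinearEquiv.ofInjectiveOfFinrankEq _ hinj hdim).toContinuousLinearEquiv, by ext <;> rfl⟩

/-- A functional `G c` vanishing on `ker P` factors as `θ ∘ P`, so `(c, θ)` solves the system with
right-hand side `(0, P v)`. -/
theorem saddle_inverse_fst {G : E →L[ℝ] E →L[ℝ] ℝ} {P : E →L[ℝ] E'}
    (hG : ∀ a, G a a = 0 → a = 0) (hP : Function.Surjective P) {c v : E} (hc : P c = P v)
    (hker : ∀ k, P k = 0 → G c k = 0) : ((saddle G P).inverse (0, P v)).1 = c := by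
  have hmem : (G c).toLinearMap ∈ LinearMap.range P.toLinearMap.dualMap := by
    rw [LinearMap.range_dualMap_eq_dualAnnihilator_ker, Submodule.mem_dualAnnihilator]
    exact fun k hk ↦ hker k hk
  obtain ⟨θ, hθ⟩ := hmem
  have h : saddle G P (c, LinearMap.toContinuousLinearMap θ) = (0, P v) := by
    rw [saddle_apply, hc]
    congr 1
    ext k
    have := congrArg (fun l : E →ₗ[ℝ] ℝ ↦ l k) hθ
    simpa [sub_eq_zero] using this.symm
  rw [← h, (saddle_isInvertible hG hP).inverse_apply_self]

theorem contMDiffAt_saddle_inverse {M : Type*} [TopologicalSpace M] [ChartedSpace E M]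
    {G : M → E →L[ℝ] E →L[ℝ] ℝ} {P : M → E →L[ℝ] E'} {u : M → E} {x : M}
    (hG : CMDiffAt ∞ G x) (hP : CMDiffAt ∞ P x) (hu : CMDiffAt ∞ u x)
    (hinv : (saddle (G x) (P x)).IsInvertible) :
    CMDiffAt ∞ (fun y ↦ ((saddle (G y) (P y)).inverse (0, P y (u y))).1) x := by
  have hQ : CMDiffAt ∞ (fun y ↦ (ContinuousLinearMap.compL ℝ E E' ℝ).flip (P y)) x :=
    (contDiff_compL_flip (E := E) (F := E') (C := ℝ)).contDiffAt.contMDiffAt.comp x hP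
  exact ContMDiffAt.comp
    (g := fun p : (E →L[ℝ] E →L[ℝ] ℝ) × ((E' →L[ℝ] ℝ) →L[ℝ] E →L[ℝ] ℝ) × (E →L[ℝ] E') × E ↦
      ((blockOp p.1 p.2.1 p.2.2.1).inverse (0, p.2.2.1 p.2.2.2)).1)
    (f := fun y ↦ (G y, (ContinuousLinearMap.compL ℝ E E' ℝ).flip (P y), P y, u y)) x
    (contDiffAt_blockOp_inverse_fst (v := u x) hinv).contMDiffAt
    (hG.prodMk_space (hQ.prodMk_space (hP.prodMk_space hu)))

end Saddle

/-! ### Vertical and horizontal projections and their smoothness. -/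

section Projections

variable {E : Type*} [NormedAddCommGroup E] [NormedSpace ℝ E] [FiniteDimensional ℝ E]
  {M : Type*} [TopologicalSpace M] [ChartedSpace E M] [IsManifold 𝓘(ℝ, E) ∞ M]
  (g : ContMDiffRiemannianMetric 𝓘(ℝ, E) ∞ E (fun x : M ↦ TangentSpace 𝓘(ℝ, E) x))
  {E' : Type*} [NormedAddCommGroup E'] [NormedSpace ℝ E'] [FiniteDimensional ℝ E']
  {N : Type*} [TopologicalSpace N] [ChartedSpace E' N] [IsManifold 𝓘(ℝ, E') ∞ N]
  {Ψ : M → N} {x : M}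

theorem mem_orth {K : Submodule ℝ (TangentSpace 𝓘(ℝ, E) x)} {v : TangentSpace 𝓘(ℝ, E) x} :
    v ∈ orth g x K ↔ ∀ w ∈ K, g.inner x w v = 0 := by
  rw [orth, LinearMap.BilinForm.mem_orthogonal_iff]
  rfl

theorem mem_vert {v : TangentSpace 𝓘(ℝ, E) x} :
    v ∈ vert 𝓘(ℝ, E) 𝓘(ℝ, E') Ψ x ↔ mfderiv 𝓘(ℝ, E) 𝓘(ℝ, E') Ψ x v = 0 := LinearMap.mem_ker

theorem vProj_mem (v : TangentSpace 𝓘(ℝ, E) x) :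
    vProj g 𝓘(ℝ, E') Ψ x v ∈ vert 𝓘(ℝ, E) 𝓘(ℝ, E') Ψ x := by
  simp [vProj]

theorem hProj_mem (v : TangentSpace 𝓘(ℝ, E) x) :
    hProj g 𝓘(ℝ, E') Ψ x v ∈ hor g 𝓘(ℝ, E') Ψ x := by
  simp [hProj, hor]

theorem vProj_add_hProj (v : TangentSpace 𝓘(ℝ, E) x) :
    vProj g 𝓘(ℝ, E') Ψ x v + hProj g 𝓘(ℝ, E') Ψ x v = v := by
  simp [hProj, vProj, Submodule.projection_add_projection_eq_self]

theorem vProj_eq_self {v : TangentSpace 𝓘(ℝ, E) x} (hv : v ∈ vert 𝓘(ℝ, E) 𝓘(ℝ, E') Ψ x) :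
    vProj g 𝓘(ℝ, E') Ψ x v = v := by
  simp [vProj, hv]

theorem hProj_eq_zero {v : TangentSpace 𝓘(ℝ, E) x} (hv : v ∈ vert 𝓘(ℝ, E) 𝓘(ℝ, E') Ψ x) :
    hProj g 𝓘(ℝ, E') Ψ x v = 0 := by
  simp [hProj, hv]

theorem hProj_eq_self {v : TangentSpace 𝓘(ℝ, E) x} (hv : v ∈ hor g 𝓘(ℝ, E') Ψ x) :
    hProj g 𝓘(ℝ, E') Ψ x v = v := by
  simp [hProj, show v ∈ orth g x _ from hv]

theorem vProj_eq_zero {v : TangentSpace 𝓘(ℝ, E) x} (hv : v ∈ hor g 𝓘(ℝ, E') Ψ x) :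
    vProj g 𝓘(ℝ, E') Ψ x v = 0 := by
  simp [vProj, show v ∈ orth g x _ from hv]

theorem inner_vert_hor {u v : TangentSpace 𝓘(ℝ, E) x} (hu : u ∈ vert 𝓘(ℝ, E) 𝓘(ℝ, E') Ψ x)
    (hv : v ∈ hor g 𝓘(ℝ, E') Ψ x) : g.inner x u v = 0 :=
  (mem_orth g).1 hv u hu

theorem inner_hor_vert {u v : TangentSpace 𝓘(ℝ, E) x} (hu : u ∈ hor g 𝓘(ℝ, E') Ψ x)
    (hv : v ∈ vert 𝓘(ℝ, E) 𝓘(ℝ, E') Ψ x) : g.inner x u v = 0 := by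
  rw [g.symm, inner_vert_hor g hv hu]

theorem mfderiv_hProj (v : TangentSpace 𝓘(ℝ, E) x) :
    mfderiv 𝓘(ℝ, E) 𝓘(ℝ, E') Ψ x (hProj g 𝓘(ℝ, E') Ψ x v) =
      mfderiv 𝓘(ℝ, E) 𝓘(ℝ, E') Ψ x v := by
  conv_rhs => rw [← vProj_add_hProj g (Ψ := Ψ) (E' := E') v, map_add]
  rw [mem_vert.1 (vProj_mem g v), zero_add]

theorem coordSymm_bijective {p q : M} (hq : q ∈ (chartAt E p).source) :
    Function.Bijective (coordSymm (E := E) p q) := by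
  have h1 : q ∈ (trivializationAt E (TangentSpace 𝓘(ℝ, E) : M → Type _) p).baseSet := hq
  have : coordSymm (E := E) p q = (((trivializationAt E (TangentSpace 𝓘(ℝ, E) : M → Type _)
      p).continuousLinearEquivAt ℝ q h1).symm : E →L[ℝ] TangentSpace 𝓘(ℝ, E) q) := by
    ext a
    rw [coordSymm, Trivialization.symmL_apply _ h1]
    rfl
  rw [this]
  exact ContinuousLinearEquiv.bijective _

theorem coordSymm_trivializationAt {p q : M} (hq : q ∈ (chartAt E p).source)
    (v : TangentSpace 𝓘(ℝ, E) q) :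
    coordSymm p q (trivializationAt E (TangentSpace 𝓘(ℝ, E) : M → Type _) p ⟨q, v⟩).2 = v := by
  rw [coordSymm, Trivialization.symmL_apply _ hq]
  exact (trivializationAt E (TangentSpace 𝓘(ℝ, E) : M → Type _) p).symm_apply_apply_mk hq v

/-- The differential of `Ψ` at `y`, read in the trivializations at `x` and `Ψ x`. -/
def coordDifferential (Ψ : M → N) (x y : M) : E →L[ℝ] E' :=
  inTangentCoordinates 𝓘(ℝ, E) 𝓘(ℝ, E') id Ψ (mfderiv 𝓘(ℝ, E) 𝓘(ℝ, E') Ψ) x y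

theorem contMDiffAt_coordDifferential (hΨ : CMDiff ∞ Ψ) (x : M) :
    CMDiffAt ∞ (coordDifferential Ψ x : M → E →L[ℝ] E') x :=
  ContMDiffAt.mfderiv_const (m := ∞) (hΨ x) (by exact le_rfl)

theorem coordDifferential_apply (x y : M) (a : E) :
    (coordDifferential Ψ x y : E →L[ℝ] E') a =
      (trivializationAt E' (TangentSpace 𝓘(ℝ, E') : N → Type _) (Ψ x)).continuousLinearMapAt ℝ
        (Ψ y) (mfderiv 𝓘(ℝ, E) 𝓘(ℝ, E') Ψ y (coordSymm x y a)) := rfl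

/-- In trivializations the projection is the first component of the solution of the saddle system
built from the metric and the differential of `Ψ`, both smooth in the base point. -/
theorem contMDiff_hProj (hΨ : CMDiff ∞ Ψ)
    (hsurj : ∀ x, Function.Surjective (mfderiv 𝓘(ℝ, E) 𝓘(ℝ, E') Ψ x))
    {X : Π x : M, TangentSpace 𝓘(ℝ, E) x} (hX : CMDiff ∞ (T% X)) :
    CMDiff ∞ (T% (fun y ↦ hProj g 𝓘(ℝ, E') Ψ y (X y))) := by
  intro x
  set t := trivializationAt E (TangentSpace 𝓘(ℝ, E) : M → Type _) x with ht
  set P : M → E →L[ℝ] E' := coordDifferential Ψ x with hPdef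
  have hG : ∀ y ∈ (chartAt E x).source, ∀ a, coordMetric g x y a a = 0 → a = 0 := by
    intro y hy a ha
    rw [coordMetric_apply g hy] at ha
    by_contra hne
    refine (g.pos y _ fun h0 ↦ hne ?_).ne' ha
    exact (coordSymm_bijective hy).1 (h0.trans (map_zero _).symm)
  have hmap : ∀ y, Ψ y ∈ (chartAt E' (Ψ x)).source → Function.Bijective
      ((trivializationAt E' (TangentSpace 𝓘(ℝ, E') : N → Type _) (Ψ x)).continuousLinearMapAt ℝ
        (Ψ y)) := by
    intro y hy
    rw [← Trivialization.coe_continuousLinearEquivAt_eq _ hy]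
    exact ContinuousLinearEquiv.bijective _
  have hP : ∀ y ∈ (chartAt E x).source, Ψ y ∈ (chartAt E' (Ψ x)).source →
      Function.Surjective (P y) := fun y hy hy' ↦
    (hmap y hy').2.comp ((hsurj y).comp (coordSymm_bijective hy).2)
  have hx := mem_chart_source E x
  have hx' := mem_chart_source E' (Ψ x)
  have hcoord : CMDiffAt ∞ (fun y ↦ (t ⟨y, X y⟩).2) x := (contMDiffAt_section _).1 (hX x)
  have hPs : CMDiffAt ∞ P x := contMDiffAt_coordDifferential hΨ x
  have hsol := contMDiffAt_saddle_inverse (contMDiffAt_coordMetric g x) hPs hcoord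
    (saddle_isInvertible (hG x hx) (hP x hx hx'))
  rw [contMDiffAt_section]
  refine hsol.congr_of_eventuallyEq ?_
  filter_upwards [eventually_mem_chart_source hΨ x,
    (chartAt E x).open_source.mem_nhds hx] with y hy' hy
  refine (saddle_inverse_fst (hG y hy) (hP y hy hy') ?_ fun k hk ↦ ?_).symm
  · rw [hPdef, coordDifferential_apply, coordDifferential_apply, coordSymm_trivializationAt hy,
      coordSymm_trivializationAt hy, mfderiv_hProj]
  · rw [coordMetric_apply g hy, coordSymm_trivializationAt hy]
    refine inner_hor_vert g (hProj_mem g _) (mem_vert.2 ((hmap y hy').1 ?_))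
    rw [← coordDifferential_apply, hk, map_zero]

theorem contMDiff_vProj (hΨ : CMDiff ∞ Ψ)
    (hsurj : ∀ x, Function.Surjective (mfderiv 𝓘(ℝ, E) 𝓘(ℝ, E') Ψ x))
    {X : Π x : M, TangentSpace 𝓘(ℝ, E) x} (hX : CMDiff ∞ (T% X)) :
    CMDiff ∞ (T% (fun y ↦ vProj g 𝓘(ℝ, E') Ψ y (X y))) := by
  have h : (fun y ↦ vProj g 𝓘(ℝ, E') Ψ y (X y)) = X - fun y ↦ hProj g 𝓘(ℝ, E') Ψ y (X y) :=
    funext fun y ↦ eq_sub_of_add_eq (vProj_add_hProj g (X y))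
  exact (hX.sub_section (contMDiff_hProj g hΨ hsurj hX)).congr fun y ↦
    congrArg (TotalSpace.mk' E y) (congrFun h y)

end Projections

end SicSubmersion
end

/-! ### Levi-Civita calculus and Sasakian identities. -/

noncomputable section
namespace SicSubmersion

set_option linter.unusedSectionVars false

section LeviCivita

variable {E : Type*} [NormedAddCommGroup E] [NormedSpace ℝ E] [FiniteDimensional ℝ E]
  {M : Type*} [TopologicalSpace M] [ChartedSpace E M] [IsManifold 𝓘(ℝ, E) ∞ M]
  {g : ContMDiffRiemannianMetric 𝓘(ℝ, E) ∞ E (fun x : M ↦ TangentSpace 𝓘(ℝ, E) x)}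
  {X Y Z : Π x : M, TangentSpace 𝓘(ℝ, E) x}

theorem mdiffAt_of_contMDiff (hX : CMDiff ∞ (T% X)) (x : M) : MDiffAt (T% X) x :=
  (hX x).mdifferentiableAt (by simp)

theorem isManifold_minSmoothness {n : WithTop ℕ∞} (hn : n ≤ ∞) :
    IsManifold 𝓘(ℝ, E) (minSmoothness ℝ n) M := by
  rw [minSmoothness_of_isRCLikeNormedField]
  exact IsManifold.of_le hn

theorem contMDiff_mlieBracket (hX : CMDiff ∞ (T% X)) (hY : CMDiff ∞ (T% Y)) :
    CMDiff ∞ (T% (mlieBracket 𝓘(ℝ, E) X Y)) := by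
  -- Here `∞ + 1` is `∞`, so the bracket of smooth fields loses no regularity.
  have : IsManifold 𝓘(ℝ, E) (((⊤ : ℕ∞) : WithTop ℕ∞) + 1) M :=
    inferInstanceAs (IsManifold 𝓘(ℝ, E) ∞ M)
  have : IsManifold 𝓘(ℝ, E) (minSmoothness ℝ 2) M := isManifold_minSmoothness two_le_infty
  exact ContDiff.mlieBracket_vectorField (m := ⊤) (n := ⊤) hX hY (by simp)

theorem mlieBracket_jacobi (hX : CMDiff ∞ (T% X)) (hY : CMDiff ∞ (T% Y)) (hZ : CMDiff ∞ (T% Z))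
    (x : M) : mlieBracket 𝓘(ℝ, E) X (mlieBracket 𝓘(ℝ, E) Y Z) x =
      mlieBracket 𝓘(ℝ, E) (mlieBracket 𝓘(ℝ, E) X Y) Z x
        + mlieBracket 𝓘(ℝ, E) Y (mlieBracket 𝓘(ℝ, E) X Z) x := by
  have : IsManifold 𝓘(ℝ, E) (minSmoothness ℝ 3) M :=
    isManifold_minSmoothness (WithTop.coe_le_coe.2 le_top)
  have h2 : minSmoothness ℝ 2 ≤ ∞ := by
    rw [minSmoothness_of_isRCLikeNormedField]; exact two_le_infty
  exact leibniz_identity_mlieBracket_apply ((hX x).of_le h2) ((hY x).of_le h2) ((hZ x).of_le h2)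

theorem nabla_sub_nabla (hX : CMDiff ∞ (T% X)) (hY : CMDiff ∞ (T% Y)) (x : M) :
    nabla g X Y x - nabla g Y X x = mlieBracket 𝓘(ℝ, E) X Y x :=
  (CovariantDerivative.torsion_eq_zero_iff _).1 (leviCivita_torsion g)
    (mdiffAt_of_contMDiff hX x) (mdiffAt_of_contMDiff hY x)

theorem mvfderiv_inner (hX : CMDiff ∞ (T% X)) (hY : CMDiff ∞ (T% Y)) (hZ : CMDiff ∞ (T% Z))
    (x : M) : d% (fun y ↦ g.inner y (Y y) (Z y)) x (X x) =
      g.inner x (nabla g X Y x) (Z x) + g.inner x (Y x) (nabla g X Z x) :=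
  leviCivita_metric g (mdiffAt_of_contMDiff hX x) (mdiffAt_of_contMDiff hY x)
    (mdiffAt_of_contMDiff hZ x)

theorem inner_nabla_of_orthogonal (hX : CMDiff ∞ (T% X)) (hY : CMDiff ∞ (T% Y))
    (hZ : CMDiff ∞ (T% Z)) (h0 : ∀ y, g.inner y (Y y) (Z y) = 0) (x : M) :
    g.inner x (nabla g X Y x) (Z x) = -g.inner x (Y x) (nabla g X Z x) := by
  have h1 := mvfderiv_inner (g := g) hX hY hZ x
  rw [funext h0, mvfderiv_const] at h1
  simp only [zero_apply] at h1
  linarith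

theorem nabla_zero (x : M) : nabla g X (fun _ ↦ 0) x = 0 := by
  have h := (leviCivita g).isCovariantDerivativeOn.zero (x := x) (Set.mem_univ x)
  exact congrArg (fun L : TangentSpace 𝓘(ℝ, E) x →L[ℝ] TangentSpace 𝓘(ℝ, E) x ↦ L (X x)) h

variable {S : AlmostContactMetricStructure g}

theorem AlmostContactMetricStructure.contMDiff_φ_apply (S : AlmostContactMetricStructure g)
    (hX : CMDiff ∞ (T% X)) : CMDiff ∞ (T% (fun y ↦ S.φ y (X y))) :=
  S.contMDiff_φ.clm_bundle_apply hX

theorem AlmostContactMetricStructure.inner_ζ_left (S : AlmostContactMetricStructure g) (x : M)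
    (v : TangentSpace 𝓘(ℝ, E) x) : g.inner x (S.ζ x) v = S.η x v := by
  rw [g.symm, S.inner_ζ]

theorem AlmostContactMetricStructure.IsSasakian.mlieBracket_ζ (hS : S.IsSasakian)
    (hX : CMDiff ∞ (T% X)) (x : M) :
    mlieBracket 𝓘(ℝ, E) S.ζ X x = nabla g S.ζ X x + S.φ x (X x) := by
  rw [← nabla_sub_nabla (g := g) S.contMDiff_ζ hX, hS.nabla_ζ X hX, sub_neg_eq_add]

/-- The characteristic vector field of a Sasakian structure is a Killing field. -/
theorem AlmostContactMetricStructure.IsSasakian.killing (hS : S.IsSasakian)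
    (hX : CMDiff ∞ (T% X)) (hY : CMDiff ∞ (T% Y)) (x : M) :
    d% (fun y ↦ g.inner y (X y) (Y y)) x (S.ζ x) =
      g.inner x (mlieBracket 𝓘(ℝ, E) S.ζ X x) (Y x)
        + g.inner x (X x) (mlieBracket 𝓘(ℝ, E) S.ζ Y x) := by
  -- Each bracket is `∇_ζ` plus a `φ` term; the two `φ` terms cancel because `φ` is skew.
  rw [mvfderiv_inner S.contMDiff_ζ hX hY, hS.mlieBracket_ζ hX, hS.mlieBracket_ζ hY]
  simp only [map_add, add_apply, S.inner_φ]
  ring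

theorem AlmostContactMetricStructure.IsSasakian.nabla_φ_apply (hS : S.IsSasakian)
    (hX : CMDiff ∞ (T% X)) (hY : CMDiff ∞ (T% Y)) (x : M) :
    nabla g X (fun y ↦ S.φ y (Y y)) x =
      S.φ x (nabla g X Y x) + (g.inner x (X x) (Y x) • S.ζ x - S.η x (Y x) • X x) := by
  rw [← hS.nabla_φ X Y hX hY, add_sub_cancel]

end LeviCivita

end SicSubmersion
end

/-! ### Conformal submersions: extensions, vertical Lie derivatives, Koszul's formula. -/

noncomputable section
namespace SicSubmersion

set_option linter.unusedSectionVars false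

variable {E : Type*} [NormedAddCommGroup E] [NormedSpace ℝ E] [FiniteDimensional ℝ E]
  {M : Type*} [TopologicalSpace M] [ChartedSpace E M] [IsManifold 𝓘(ℝ, E) ∞ M] [T2Space M]
  {E' : Type*} [NormedAddCommGroup E'] [NormedSpace ℝ E'] [FiniteDimensional ℝ E']
  {N : Type*} [TopologicalSpace N] [ChartedSpace E' N] [IsManifold 𝓘(ℝ, E') ∞ N]
  {g : ContMDiffRiemannianMetric 𝓘(ℝ, E) ∞ E (fun x : M ↦ TangentSpace 𝓘(ℝ, E) x)}
  {h : ContMDiffRiemannianMetric 𝓘(ℝ, E') ∞ E' (fun y : N ↦ TangentSpace 𝓘(ℝ, E') y)}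
  {S : AlmostContactMetricStructure g} {Ψ : M → N} {lam : M → ℝ}
  {D₁ : Π x : M, Submodule ℝ (TangentSpace 𝓘(ℝ, E) x)}
  {U V X Y Z : Π x : M, TangentSpace 𝓘(ℝ, E) x}

namespace IsConformalSubmersion

theorem exists_vert_section (hc : IsConformalSubmersion g h Ψ lam) {x : M}
    {v : TangentSpace 𝓘(ℝ, E) x} (hv : v ∈ vert 𝓘(ℝ, E) 𝓘(ℝ, E') Ψ x) :
    ∃ V, IsSection (vert 𝓘(ℝ, E) 𝓘(ℝ, E') Ψ) V ∧ V x = v := by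
  obtain ⟨X, hX, hXx⟩ := exists_contMDiff_vectorField_apply_eq v
  exact ⟨fun y ↦ vProj g 𝓘(ℝ, E') Ψ y (X y),
    ⟨contMDiff_vProj g hc.contMDiff hc.surjective_mfderiv hX, fun y ↦ vProj_mem g _⟩,
    by simp only [hXx, vProj_eq_self g hv]⟩

theorem exists_hor_section (hc : IsConformalSubmersion g h Ψ lam) {x : M}
    {v : TangentSpace 𝓘(ℝ, E) x} (hv : v ∈ hor g 𝓘(ℝ, E') Ψ x) :
    ∃ V, IsSection (hor g 𝓘(ℝ, E') Ψ) V ∧ V x = v := by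
  obtain ⟨X, hX, hXx⟩ := exists_contMDiff_vectorField_apply_eq v
  exact ⟨fun y ↦ hProj g 𝓘(ℝ, E') Ψ y (X y),
    ⟨contMDiff_hProj g hc.contMDiff hc.surjective_mfderiv hX, fun y ↦ hProj_mem g _⟩,
    by simp only [hXx, hProj_eq_self g hv]⟩

theorem inner_mfderiv (hc : IsConformalSubmersion g h Ψ lam) {x : M}
    (u : TangentSpace 𝓘(ℝ, E) x) {v : TangentSpace 𝓘(ℝ, E) x} (hv : v ∈ hor g 𝓘(ℝ, E') Ψ x) :
    h.inner (Ψ x) (mfderiv 𝓘(ℝ, E) 𝓘(ℝ, E') Ψ x u) (mfderiv 𝓘(ℝ, E) 𝓘(ℝ, E') Ψ x v)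
      = lam x ^ 2 * g.inner x u v := by
  rw [← mfderiv_hProj g u, hc.conformal x _ (hProj_mem g u) v hv]
  conv_rhs => rw [← vProj_add_hProj g (Ψ := Ψ) (E' := E') u, map_add, add_apply,
    inner_vert_hor g (vProj_mem g u) hv, zero_add]

theorem inner_mfderiv' (hc : IsConformalSubmersion g h Ψ lam) {x : M}
    {u : TangentSpace 𝓘(ℝ, E) x} (v : TangentSpace 𝓘(ℝ, E) x) (hu : u ∈ hor g 𝓘(ℝ, E') Ψ x) :
    h.inner (Ψ x) (mfderiv 𝓘(ℝ, E) 𝓘(ℝ, E') Ψ x u) (mfderiv 𝓘(ℝ, E) 𝓘(ℝ, E') Ψ x v)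
      = lam x ^ 2 * g.inner x u v := by
  rw [h.symm, hc.inner_mfderiv v hu, g.symm]

/-- A vertical field and the zero field have the same push-forward; the torsion identity against the
zero field leaves only this term. -/
theorem pullbackNabla_vert (hc : IsConformalSubmersion g h Ψ lam)
    (hU : IsSection (vert 𝓘(ℝ, E) 𝓘(ℝ, E') Ψ) U) {x : M} (v : TangentSpace 𝓘(ℝ, E) x) :
    pullbackNabla h Ψ (fun y ↦ mfderiv 𝓘(ℝ, E) 𝓘(ℝ, E') Ψ y (U y)) x v = 0 := by
  obtain ⟨X, hX, hXx⟩ := exists_contMDiff_vectorField_apply_eq v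
  have h0 : CMDiff ∞ (T% (0 : Π x : M, TangentSpace 𝓘(ℝ, E) x)) :=
    contMDiff_zeroSection ℝ (TangentSpace 𝓘(ℝ, E) : M → Type _)
  have hz : (fun y ↦ mfderiv 𝓘(ℝ, E) 𝓘(ℝ, E') Ψ y (U y)) =
      fun y ↦ mfderiv 𝓘(ℝ, E) 𝓘(ℝ, E') Ψ y ((0 : Π x : M, TangentSpace 𝓘(ℝ, E) x) y) := by
    funext y
    rw [mem_vert.1 (hU.2 y), Pi.zero_apply, map_zero]
  have key := pullbackNabla_mfderiv_sub h hc.contMDiff (mdiffAt_of_contMDiff hX x)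
    (mdiffAt_of_contMDiff h0 x)
  rw [hz, ← hXx]
  simpa using key

theorem mlieBracket_mem_vert (hc : IsConformalSubmersion g h Ψ lam)
    (hU : IsSection (vert 𝓘(ℝ, E) 𝓘(ℝ, E') Ψ) U) (hV : IsSection (vert 𝓘(ℝ, E) 𝓘(ℝ, E') Ψ) V)
    (x : M) : mlieBracket 𝓘(ℝ, E) U V x ∈ vert 𝓘(ℝ, E) 𝓘(ℝ, E') Ψ x := by
  rw [mem_vert, ← pullbackNabla_mfderiv_sub h hc.contMDiff (mdiffAt_of_contMDiff hU.1 x)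
    (mdiffAt_of_contMDiff hV.1 x), hc.pullbackNabla_vert hU, hc.pullbackNabla_vert hV, sub_zero]

theorem mvfderiv_inner_mfderiv (hc : IsConformalSubmersion g h Ψ lam) (hX : CMDiff ∞ (T% X))
    (hY : CMDiff ∞ (T% Y)) {x : M} (v : TangentSpace 𝓘(ℝ, E) x) :
    d% (fun y ↦ h.inner (Ψ y) (mfderiv 𝓘(ℝ, E) 𝓘(ℝ, E') Ψ y (X y))
        (mfderiv 𝓘(ℝ, E) 𝓘(ℝ, E') Ψ y (Y y))) x v =
      h.inner (Ψ x) (pullbackNabla h Ψ (fun y ↦ mfderiv 𝓘(ℝ, E) 𝓘(ℝ, E') Ψ y (X y)) x v)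
        (mfderiv 𝓘(ℝ, E) 𝓘(ℝ, E') Ψ x (Y x))
      + h.inner (Ψ x) (mfderiv 𝓘(ℝ, E) 𝓘(ℝ, E') Ψ x (X x))
        (pullbackNabla h Ψ (fun y ↦ mfderiv 𝓘(ℝ, E) 𝓘(ℝ, E') Ψ y (Y y)) x v) :=
  mvfderiv_inner_pullback h hc.contMDiff
    (mdiff_pullbackCoord_mfderiv hc.contMDiff (mdiffAt_of_contMDiff hX x))
    (mdiff_pullbackCoord_mfderiv hc.contMDiff (mdiffAt_of_contMDiff hY x)) v

/-- The Lie derivative along a vertical field of the pulled back metric vanishes. -/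
theorem mvfderiv_sq_mul_inner_vert (hc : IsConformalSubmersion g h Ψ lam)
    (hU : IsSection (vert 𝓘(ℝ, E) 𝓘(ℝ, E') Ψ) U) (hX : IsSection (hor g 𝓘(ℝ, E') Ψ) X)
    (hY : IsSection (hor g 𝓘(ℝ, E') Ψ) Y) (x : M) :
    d% (fun y ↦ lam y ^ 2 * g.inner y (X y) (Y y)) x (U x) =
      lam x ^ 2 * (g.inner x (mlieBracket 𝓘(ℝ, E) U X x) (Y x)
        + g.inner x (X x) (mlieBracket 𝓘(ℝ, E) U Y x)) := by
  have e : (fun y ↦ lam y ^ 2 * g.inner y (X y) (Y y)) = fun y ↦ h.inner (Ψ y)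
      (mfderiv 𝓘(ℝ, E) 𝓘(ℝ, E') Ψ y (X y)) (mfderiv 𝓘(ℝ, E) 𝓘(ℝ, E') Ψ y (Y y)) :=
    funext fun y ↦ (hc.inner_mfderiv (X y) (hY.2 y)).symm
  have t1 := pullbackNabla_mfderiv_sub h hc.contMDiff (mdiffAt_of_contMDiff hU.1 x)
    (mdiffAt_of_contMDiff hX.1 x)
  have t2 := pullbackNabla_mfderiv_sub h hc.contMDiff (mdiffAt_of_contMDiff hU.1 x)
    (mdiffAt_of_contMDiff hY.1 x)
  -- Torsion-freeness now reads `∇^Ψ_U Ψ_* X = Ψ_* [U, X]` for vertical `U`.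
  rw [hc.pullbackNabla_vert hU, sub_zero] at t1 t2
  rw [e, hc.mvfderiv_inner_mfderiv hX.1 hY.1, t1, t2, hc.inner_mfderiv _ (hY.2 x),
    hc.inner_mfderiv' _ (hX.2 x)]
  ring

/-- Koszul's formula for the pullback connection of a conformal submersion. -/
theorem inner_pullbackNabla (hc : IsConformalSubmersion g h Ψ lam)
    (hlam : ∀ x, MDiffAt (fun y ↦ lam y ^ 2) x)
    (hX : IsSection (hor g 𝓘(ℝ, E') Ψ) X) (hY : IsSection (hor g 𝓘(ℝ, E') Ψ) Y)
    (hZ : IsSection (hor g 𝓘(ℝ, E') Ψ) Z) (hXZ : ∀ y, g.inner y (X y) (Z y) = 0)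
    (hZY : ∀ y, g.inner y (Z y) (Y y) = 0) (x : M) :
    h.inner (Ψ x) (pullbackNabla h Ψ (fun y ↦ mfderiv 𝓘(ℝ, E) 𝓘(ℝ, E') Ψ y (Z y)) x (X x))
        (mfderiv 𝓘(ℝ, E) 𝓘(ℝ, E') Ψ x (Y x)) =
      lam x ^ 2 * g.inner x (nabla g X Z x) (Y x)
        + 1 / 2 * (d% (fun y ↦ lam y ^ 2) x (Z x) * g.inner x (X x) (Y x)) := by
  have e (A B : Π x : M, TangentSpace 𝓘(ℝ, E) x) (hB : IsSection (hor g 𝓘(ℝ, E') Ψ) B) :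
      (fun y ↦ h.inner (Ψ y) (mfderiv 𝓘(ℝ, E) 𝓘(ℝ, E') Ψ y (A y))
        (mfderiv 𝓘(ℝ, E) 𝓘(ℝ, E') Ψ y (B y))) = fun y ↦ lam y ^ 2 * g.inner y (A y) (B y) :=
    funext fun y ↦ hc.inner_mfderiv (A y) (hB.2 y)
  have m {A : Π x : M, TangentSpace 𝓘(ℝ, E) x} (hA : IsSection (hor g 𝓘(ℝ, E') Ψ) A) :=
    mdiffAt_of_contMDiff hA.1 x
  have d1 := hc.mvfderiv_inner_mfderiv hZ.1 hY.1 (X x)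
  have d2 := hc.mvfderiv_inner_mfderiv hX.1 hY.1 (Z x)
  have d3 := hc.mvfderiv_inner_mfderiv hX.1 hZ.1 (Y x)
  rw [e Z Y hY] at d1
  rw [e X Y hY, mvfderiv_fun_mul (hlam x) (mdiff_metric g (m hX) (m hY))] at d2
  rw [e X Z hZ] at d3
  simp only [hZY, hXZ, mul_zero, mvfderiv_const, zero_apply] at d1 d3
  have t1 := pullbackNabla_mfderiv_sub h hc.contMDiff (m hX) (m hZ)
  have t2 := pullbackNabla_mfderiv_sub h hc.contMDiff (m hX) (m hY)
  have t3 := pullbackNabla_mfderiv_sub h hc.contMDiff (m hZ) (m hY)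
  have k := inner_leviCivitaFun g (m hX) (m hZ) (m hY)
  simp only [koszul, hZY, hXZ, mvfderiv_const, zero_apply] at k
  have i1 := hc.inner_mfderiv (mlieBracket 𝓘(ℝ, E) X Z x) (hY.2 x)
  have i2 := hc.inner_mfderiv' (mlieBracket 𝓘(ℝ, E) X Y x) (hZ.2 x)
  have i3 := hc.inner_mfderiv' (mlieBracket 𝓘(ℝ, E) Z Y x) (hX.2 x)
  rw [← t1] at i1
  rw [← t2] at i2
  rw [← t3] at i3
  simp only [map_sub, sub_apply, add_apply, smul_apply, smul_eq_mul] at i1 i2 i3 d2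
  have k' : nabla g X Z x = leviCivitaFun g Z x (X x) := rfl
  rw [g.symm x (Z x)] at i2
  rw [g.symm x (X x) (mlieBracket 𝓘(ℝ, E) Z Y x)] at i3
  rw [k', k]
  rw [h.symm (Ψ x) _ (mfderiv 𝓘(ℝ, E) 𝓘(ℝ, E') Ψ x (Z x))] at d3
  -- Both Koszul formulas have the same bracket terms up to `λ²`. As `Z` is orthogonal to `X` and
  -- `Y`, the only differentiated product is `g(X, Y)` along `Z`, and the product rule gives the
  -- correction in `d(λ²)(Z)`.
  linear_combination (1 / 2) * (-d1 - d2 + d3 + i1 - i2 - i3)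

end IsConformalSubmersion

/-! ### Constancy of the dilation along fibres, and brackets with `ζ`. -/

namespace IsSicSubmersion

theorem isSection_ζ (hΨ : IsSicSubmersion h S Ψ lam D₁) : IsSection (hor g 𝓘(ℝ, E') Ψ) S.ζ :=
  ⟨S.contMDiff_ζ, hΨ.ζ_mem⟩

theorem η_vert (hΨ : IsSicSubmersion h S Ψ lam D₁) {x : M} {v : TangentSpace 𝓘(ℝ, E) x}
    (hv : v ∈ vert 𝓘(ℝ, E) 𝓘(ℝ, E') Ψ x) : S.η x v = 0 := by
  rw [← S.inner_ζ, inner_vert_hor g hv (hΨ.ζ_mem x)]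

/-- As `ζ` is unit and horizontal, `λ²` is the squared length of `Ψ_* ζ`. This supplies the
differentiability of the dilation, which is not part of the definition. -/
theorem sq_eq (hΨ : IsSicSubmersion h S Ψ lam D₁) :
    (fun y ↦ lam y ^ 2) = fun y ↦ h.inner (Ψ y) (mfderiv 𝓘(ℝ, E) 𝓘(ℝ, E') Ψ y (S.ζ y))
      (mfderiv 𝓘(ℝ, E) 𝓘(ℝ, E') Ψ y (S.ζ y)) := by
  funext y
  rw [hΨ.inner_mfderiv (S.ζ y) (hΨ.ζ_mem y), S.inner_ζ, S.η_ζ, mul_one]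

theorem mdiff_sq (hΨ : IsSicSubmersion h S Ψ lam D₁) (x : M) : MDiffAt (fun y ↦ lam y ^ 2) x := by
  rw [hΨ.sq_eq]
  exact mdiff_inner_pullback h hΨ.contMDiff
    (mdiff_pullbackCoord_mfderiv hΨ.contMDiff (mdiffAt_of_contMDiff S.contMDiff_ζ x))
    (mdiff_pullbackCoord_mfderiv hΨ.contMDiff (mdiffAt_of_contMDiff S.contMDiff_ζ x))

theorem mvfderiv_sq (hΨ : IsSicSubmersion h S Ψ lam D₁) {x : M} (v : TangentSpace 𝓘(ℝ, E) x) :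
    d% (fun y ↦ lam y ^ 2) x v =
      2 * (lam x ^ 2 * g.inner x (grad g (fun y ↦ Real.log (lam y)) x) v) := by
  have hpos : lam x ^ 2 ≠ 0 := (pow_pos (hΨ.lam_pos x) 2).ne'
  have hlog : (fun y ↦ Real.log (lam y)) = (fun t ↦ 2⁻¹ * Real.log t) ∘ fun y ↦ lam y ^ 2 := by
    funext y
    simp
  have hd : HasDerivAt (fun t : ℝ ↦ 2⁻¹ * Real.log t) (2⁻¹ * (lam x ^ 2)⁻¹) (lam x ^ 2) :=
    (Real.hasDerivAt_log hpos).const_mul _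
  have h1 : d% (fun y ↦ Real.log (lam y)) x v =
      (2⁻¹ * (lam x ^ 2)⁻¹) * d% (fun y ↦ lam y ^ 2) x v := by
    rw [hlog, mvfderiv_comp_apply x hd.differentiableAt.mdifferentiableAt (hΨ.mdiff_sq x)]
    change mfderiv 𝓘(ℝ, ℝ) 𝓘(ℝ, ℝ) (fun t : ℝ ↦ 2⁻¹ * Real.log t) (lam x ^ 2)
      (d% (fun y ↦ lam y ^ 2) x v) = _
    rw [mfderiv_eq_fderiv, hd.hasFDerivAt.fderiv]
    change (d% (fun y ↦ lam y ^ 2) x v) * (2⁻¹ * (lam x ^ 2)⁻¹) = _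
    exact mul_comm _ _
  rw [grad, inner_sharp]
  change _ = 2 * (lam x ^ 2 * d% (fun y ↦ Real.log (lam y)) x v)
  rw [h1]
  linear_combination -(d% (fun y ↦ lam y ^ 2) x v) * mul_inv_cancel₀ hpos

/-- From `λ² = |Ψ_* ζ|²` one gets `U(λ²) = 2λ² g([U, ζ], ζ)`, and the Killing equation applied to
`g(U, ζ) = 0` makes this zero. -/
theorem mvfderiv_sq_vert (hΨ : IsSicSubmersion h S Ψ lam D₁) (hS : S.IsSasakian)
    (hU : IsSection (vert 𝓘(ℝ, E) 𝓘(ℝ, E') Ψ) U) (x : M) :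
    d% (fun y ↦ lam y ^ 2) x (U x) = 0 := by
  have h1 := hΨ.mvfderiv_sq_mul_inner_vert hU hΨ.isSection_ζ hΨ.isSection_ζ x
  have h2 := hS.killing hU.1 S.contMDiff_ζ x
  have h0 : ∀ y, g.inner y (U y) (S.ζ y) = 0 := fun y ↦ inner_vert_hor g (hU.2 y) (hΨ.ζ_mem y)
  have hζ : mlieBracket 𝓘(ℝ, E) S.ζ S.ζ x = 0 := by
    rw [← nabla_sub_nabla (g := g) S.contMDiff_ζ S.contMDiff_ζ, sub_self]
  have hsw := mlieBracket_swap_apply (I := 𝓘(ℝ, E)) (V := U) (W := S.ζ) (x := x)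
  simp only [S.inner_ζ, S.inner_ζ_left, S.η_ζ, mul_one] at h1
  simp only [h0, mvfderiv_const, zero_apply, hζ, map_zero, add_zero, S.inner_ζ] at h2
  rw [h1, hsw, map_neg, ← h2]
  simp

/-- The horizontal metric is invariant under vertical flows. -/
theorem mvfderiv_inner_vert (hΨ : IsSicSubmersion h S Ψ lam D₁) (hS : S.IsSasakian)
    (hU : IsSection (vert 𝓘(ℝ, E) 𝓘(ℝ, E') Ψ) U) (hX : IsSection (hor g 𝓘(ℝ, E') Ψ) X)
    (hY : IsSection (hor g 𝓘(ℝ, E') Ψ) Y) (x : M) :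
    d% (fun y ↦ g.inner y (X y) (Y y)) x (U x) =
      g.inner x (mlieBracket 𝓘(ℝ, E) U X x) (Y x)
        + g.inner x (X x) (mlieBracket 𝓘(ℝ, E) U Y x) := by
  have h1 := hΨ.mvfderiv_sq_mul_inner_vert hU hX hY x
  rw [mvfderiv_fun_mul (hΨ.mdiff_sq x)
    (mdiff_metric g (mdiffAt_of_contMDiff hX.1 x) (mdiffAt_of_contMDiff hY.1 x))] at h1
  simp only [add_apply, smul_apply, smul_eq_mul, hΨ.mvfderiv_sq_vert hS hU x, mul_zero,
    add_zero] at h1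
  exact mul_left_cancel₀ (pow_pos (hΨ.lam_pos x) 2).ne' h1

/-- Expand `U g(X, ζ)` both by invariance of the horizontal metric and by the Levi-Civita
connection. One copy of `g(φU, X)` comes from `∇_U ζ`, the other from `∇_X ζ`. -/
theorem inner_mlieBracket_ζ_hor (hΨ : IsSicSubmersion h S Ψ lam D₁) (hS : S.IsSasakian)
    (hU : IsSection (vert 𝓘(ℝ, E) 𝓘(ℝ, E') Ψ) U) {x : M} {v : TangentSpace 𝓘(ℝ, E) x}
    (hv : v ∈ hor g 𝓘(ℝ, E') Ψ x) :
    g.inner x (mlieBracket 𝓘(ℝ, E) S.ζ U x) v = 2 * g.inner x (S.φ x (U x)) v := by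
  obtain ⟨X, hX, rfl⟩ := hΨ.exists_hor_section hv
  have h1 := hΨ.mvfderiv_inner_vert hS hU hX hΨ.isSection_ζ x
  rw [mvfderiv_inner hU.1 hX.1 S.contMDiff_ζ, ← nabla_sub_nabla (g := g) hU.1 hX.1,
    hS.nabla_ζ U hU.1, mlieBracket_swap_apply (V := U)] at h1
  have h2 := inner_nabla_of_orthogonal (g := g) hX.1 hU.1 S.contMDiff_ζ
    (fun y ↦ inner_vert_hor g (hU.2 y) (hΨ.ζ_mem y)) x
  rw [hS.nabla_ζ X hX.1] at h2
  have h3 := S.inner_φ x (U x) (X x)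
  simp only [map_sub, sub_apply, map_neg] at h1 h2
  rw [g.symm x (X x), g.symm x (X x)] at h1
  linarith

/-- The Killing equation for `g(X, V) = 0` moves the bracket from `X` to the vertical field `V`. -/
theorem inner_mlieBracket_ζ_vert (hΨ : IsSicSubmersion h S Ψ lam D₁) (hS : S.IsSasakian)
    (hX : IsSection (hor g 𝓘(ℝ, E') Ψ) X) {x : M} {v : TangentSpace 𝓘(ℝ, E) x}
    (hv : v ∈ vert 𝓘(ℝ, E) 𝓘(ℝ, E') Ψ x) :
    g.inner x (mlieBracket 𝓘(ℝ, E) S.ζ X x) v = -2 * g.inner x (S.φ x v) (X x) := by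
  obtain ⟨V, hV, rfl⟩ := hΨ.exists_vert_section hv
  have h1 := hS.killing hX.1 hV.1 x
  have h0 : ∀ y, g.inner y (X y) (V y) = 0 := fun y ↦ inner_hor_vert g (hX.2 y) (hV.2 y)
  simp only [h0, mvfderiv_const, zero_apply] at h1
  rw [g.symm x (X x), hΨ.inner_mlieBracket_ζ_hor hS hV (hX.2 x)] at h1
  linarith

end IsSicSubmersion

end SicSubmersion
end

/-! ### The key identity when `φ` maps vertical to horizontal; algebra of `D₁` and `D₂`. -/

noncomputable section
namespace SicSubmersion

set_option linter.unusedSectionVars false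

variable {E : Type*} [NormedAddCommGroup E] [NormedSpace ℝ E] [FiniteDimensional ℝ E]
  {M : Type*} [TopologicalSpace M] [ChartedSpace E M] [IsManifold 𝓘(ℝ, E) ∞ M] [T2Space M]
  {E' : Type*} [NormedAddCommGroup E'] [NormedSpace ℝ E'] [FiniteDimensional ℝ E']
  {N : Type*} [TopologicalSpace N] [ChartedSpace E' N] [IsManifold 𝓘(ℝ, E') ∞ N]
  {g : ContMDiffRiemannianMetric 𝓘(ℝ, E) ∞ E (fun x : M ↦ TangentSpace 𝓘(ℝ, E) x)}
  {h : ContMDiffRiemannianMetric 𝓘(ℝ, E') ∞ E' (fun y : N ↦ TangentSpace 𝓘(ℝ, E') y)}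
  {S : AlmostContactMetricStructure g} {Ψ : M → N} {lam : M → ℝ}
  {D₁ : Π x : M, Submodule ℝ (TangentSpace 𝓘(ℝ, E) x)}
  {U V X Y Z : Π x : M, TangentSpace 𝓘(ℝ, E) x}

variable (g) in
theorem mem_vert_of_inner_hor {x : M} {v : TangentSpace 𝓘(ℝ, E) x}
    (hv : ∀ w ∈ hor g 𝓘(ℝ, E') Ψ x, g.inner x v w = 0) : v ∈ vert 𝓘(ℝ, E) 𝓘(ℝ, E') Ψ x := by
  have h0 : hProj g 𝓘(ℝ, E') Ψ x v = 0 := by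
    by_contra hne
    refine (g.pos x _ hne).ne' ?_
    have h1 := hv _ (hProj_mem g v)
    rw [← vProj_add_hProj g (Ψ := Ψ) (E' := E') v, map_add, add_apply,
      vProj_add_hProj, inner_vert_hor g (vProj_mem g v) (hProj_mem g v), zero_add] at h1
    exact h1
  rw [← vProj_add_hProj g (Ψ := Ψ) (E' := E') v, h0, add_zero]
  exact vProj_mem g v

namespace IsSicSubmersion

/-- This writes `2φU` as `[ζ, U]` minus a vertical field, which gives access to Lie derivatives
along `φU`. -/
theorem isSection_mlieBracket_ζ_vert (hΨ : IsSicSubmersion h S Ψ lam D₁) (hS : S.IsSasakian)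
    (hU : IsSection (vert 𝓘(ℝ, E) 𝓘(ℝ, E') Ψ) U) :
    IsSection (vert 𝓘(ℝ, E) 𝓘(ℝ, E') Ψ)
      (mlieBracket 𝓘(ℝ, E) S.ζ U + (-2 : ℝ) • fun y ↦ S.φ y (U y)) := by
  refine ⟨(contMDiff_mlieBracket S.contMDiff_ζ hU.1).add_section
    (S.contMDiff_φ_apply hU.1).const_smul_section, fun x ↦ mem_vert_of_inner_hor g fun w hw ↦ ?_⟩
  simp only [Pi.add_apply, Pi.smul_apply, map_add, map_smul, add_apply, smul_apply, smul_eq_mul,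
    hΨ.inner_mlieBracket_ζ_hor hS hU hw]
  ring

theorem isSection_mlieBracket_ζ (hΨ : IsSicSubmersion h S Ψ lam D₁) (hS : S.IsSasakian)
    (hZ : IsSection (hor g 𝓘(ℝ, E') Ψ) Z)
    (hZφ : ∀ x, ∀ w ∈ vert 𝓘(ℝ, E) 𝓘(ℝ, E') Ψ x, g.inner x (Z x) (S.φ x w) = 0) :
    IsSection (hor g 𝓘(ℝ, E') Ψ) (mlieBracket 𝓘(ℝ, E) S.ζ Z) := by
  refine ⟨contMDiff_mlieBracket S.contMDiff_ζ hZ.1, fun x ↦ (mem_orth g).2 fun w hw ↦ ?_⟩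
  rw [g.symm, hΨ.inner_mlieBracket_ζ_vert hS hZ hw, g.symm, hZφ x w hw, mul_zero]

theorem isSection_φ (hφ : ∀ x, ∀ v ∈ vert 𝓘(ℝ, E) 𝓘(ℝ, E') Ψ x, S.φ x v ∈ hor g 𝓘(ℝ, E') Ψ x)
    (hV : IsSection (vert 𝓘(ℝ, E) 𝓘(ℝ, E') Ψ) V) :
    IsSection (hor g 𝓘(ℝ, E') Ψ) fun y ↦ S.φ y (V y) :=
  ⟨S.contMDiff_φ_apply hV.1, fun x ↦ hφ x _ (hV.2 x)⟩

/-- The vertical part of `[ζ, φV]` is `-2V`, since `φ` is isometric on vertical vectors. The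
correction `2V` is the source of the term `g([U, Z], V)` below. -/
theorem isSection_mlieBracket_ζ_φ (hΨ : IsSicSubmersion h S Ψ lam D₁) (hS : S.IsSasakian)
    (hφ : ∀ x, ∀ v ∈ vert 𝓘(ℝ, E) 𝓘(ℝ, E') Ψ x, S.φ x v ∈ hor g 𝓘(ℝ, E') Ψ x)
    (hV : IsSection (vert 𝓘(ℝ, E) 𝓘(ℝ, E') Ψ) V) :
    IsSection (hor g 𝓘(ℝ, E') Ψ)
      (mlieBracket 𝓘(ℝ, E) S.ζ (fun y ↦ S.φ y (V y)) + (2 : ℝ) • V) := by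
  refine ⟨(contMDiff_mlieBracket S.contMDiff_ζ (S.contMDiff_φ_apply hV.1)).add_section
    hV.1.const_smul_section, fun x ↦ (mem_orth g).2 fun w hw ↦ ?_⟩
  rw [g.symm, Pi.add_apply, map_add, add_apply,
    hΨ.inner_mlieBracket_ζ_vert hS (isSection_φ hφ hV) hw, S.inner_φ_φ, hΨ.η_vert hw, Pi.smul_apply,
    map_smul, smul_apply, smul_eq_mul, g.symm x (V x)]
  ring

/-- The Lie derivative of the horizontal metric along `φ U`, for vertical `U`. -/
theorem inner_mlieBracket_φ (hΨ : IsSicSubmersion h S Ψ lam D₁) (hS : S.IsSasakian)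
    (hφ : ∀ x, ∀ v ∈ vert 𝓘(ℝ, E) 𝓘(ℝ, E') Ψ x, S.φ x v ∈ hor g 𝓘(ℝ, E') Ψ x)
    (hU : IsSection (vert 𝓘(ℝ, E) 𝓘(ℝ, E') Ψ) U) (hV : IsSection (vert 𝓘(ℝ, E) 𝓘(ℝ, E') Ψ) V)
    (hZ : IsSection (hor g 𝓘(ℝ, E') Ψ) Z)
    (hZφ : ∀ x, ∀ w ∈ vert 𝓘(ℝ, E) 𝓘(ℝ, E') Ψ x, g.inner x (Z x) (S.φ x w) = 0) (x : M) :
    g.inner x (mlieBracket 𝓘(ℝ, E) U Z x) (V x) =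
      g.inner x (mlieBracket 𝓘(ℝ, E) (fun y ↦ S.φ y (U y)) Z x) (S.φ x (V x))
        + g.inner x (Z x)
          (mlieBracket 𝓘(ℝ, E) (fun y ↦ S.φ y (U y)) (fun y ↦ S.φ y (V y)) x) := by
  set Y : Π x : M, TangentSpace 𝓘(ℝ, E) x := fun y ↦ S.φ y (V y) with hYdef
  set A : Π x : M, TangentSpace 𝓘(ℝ, E) x := fun y ↦ S.φ y (U y) with hAdef
  have hY : IsSection (hor g 𝓘(ℝ, E') Ψ) Y := isSection_φ hφ hV
  have hA : CMDiff ∞ (T% A) := S.contMDiff_φ_apply hU.1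
  have hW := hΨ.isSection_mlieBracket_ζ_vert hS hU
  have hP := hΨ.isSection_mlieBracket_ζ hS hZ hZφ
  have hQ := hΨ.isSection_mlieBracket_ζ_φ hS hφ hV
  rw [← hAdef] at hW
  rw [← hYdef] at hQ
  have hZY : ∀ y, g.inner y (Z y) (Y y) = 0 := fun y ↦ hZφ y _ (hV.2 y)
  have hZV : ∀ y, g.inner y (Z y) (V y) = 0 := fun y ↦ inner_hor_vert g (hZ.2 y) (hV.2 y)
  have m {B : Π x : M, TangentSpace 𝓘(ℝ, E) x} (hB : CMDiff ∞ (T% B)) :=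
    mdiffAt_of_contMDiff hB x
  have cUZ := contMDiff_mlieBracket hU.1 hZ.1
  have cUY := contMDiff_mlieBracket hU.1 hY.1
  have cζU := contMDiff_mlieBracket S.contMDiff_ζ hU.1
  have cζY := contMDiff_mlieBracket S.contMDiff_ζ hY.1
  -- Invariance of the horizontal metric is used along `[ζ, U] - 2φU`, and along `U` for the
  -- corrected brackets with `ζ`, all horizontal.
  have sW := hΨ.mvfderiv_inner_vert hS hW hZ hY x
  have sP := hΨ.mvfderiv_inner_vert hS hU hP hY x
  have sQ := hΨ.mvfderiv_inner_vert hS hU hZ hQ x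
  have k1 := hS.killing cUZ hY.1 x
  have k2 := hS.killing hZ.1 cUY x
  have j1 := mlieBracket_jacobi S.contMDiff_ζ hU.1 hZ.1 x
  have j2 := mlieBracket_jacobi S.contMDiff_ζ hU.1 hY.1 x
  -- First order of differentiation: invariance along `U` for the orthogonal pair `Z`, `φV`, then
  -- the derivative along `ζ`.
  have dUZY : d% (fun y ↦ g.inner y (mlieBracket 𝓘(ℝ, E) U Z y) (Y y)) x (S.ζ x)
      + d% (fun y ↦ g.inner y (Z y) (mlieBracket 𝓘(ℝ, E) U Y y)) x (S.ζ x) = 0 := by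
    have e : ∀ y, g.inner y (mlieBracket 𝓘(ℝ, E) U Z y) (Y y)
        + g.inner y (Z y) (mlieBracket 𝓘(ℝ, E) U Y y) = 0 := fun y ↦ by
      rw [← hΨ.mvfderiv_inner_vert hS hU hZ hY y, funext hZY, mvfderiv_const, zero_apply]
    rw [← add_apply, ← mvfderiv_fun_add (mdiff_metric g (m cUZ) (m hY.1))
      (mdiff_metric g (m hZ.1) (m cUY)), funext e, mvfderiv_const, zero_apply]
  -- Opposite order: the Killing equation for the same pair, then the derivative along `U`. Adding
  -- `2V` changes nothing because `Z` is orthogonal to `V`.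
  have dPQ : d% (fun y ↦ g.inner y (mlieBracket 𝓘(ℝ, E) S.ζ Z y) (Y y)) x (U x)
      + d% (fun y ↦ g.inner y (Z y) ((mlieBracket 𝓘(ℝ, E) S.ζ Y + (2 : ℝ) • V) y)) x (U x) = 0 := by
    have e : ∀ y, g.inner y (mlieBracket 𝓘(ℝ, E) S.ζ Z y) (Y y)
        + g.inner y (Z y) ((mlieBracket 𝓘(ℝ, E) S.ζ Y + (2 : ℝ) • V) y) = 0 := fun y ↦ by
      rw [Pi.add_apply, map_add, Pi.smul_apply, map_smul, hZV, smul_zero, add_zero,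
        ← hS.killing hZ.1 hY.1 y, funext hZY, mvfderiv_const, zero_apply]
    rw [← add_apply, ← mvfderiv_fun_add (mdiff_metric g (m hP.1) (m hY.1))
      (mdiff_metric g (m hZ.1) (m hQ.1)), funext e, mvfderiv_const, zero_apply]
  have hUV : g.inner x (Z x) (mlieBracket 𝓘(ℝ, E) U V x) = 0 :=
    inner_hor_vert g (hZ.2 x) (hΨ.mlieBracket_mem_vert hU hV x)
  have cA : CMDiff ∞ (T% ((-2 : ℝ) • A)) := hA.const_smul_section
  have cV : CMDiff ∞ (T% ((2 : ℝ) • V)) := hV.1.const_smul_section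
  rw [funext hZY, mvfderiv_const, zero_apply, mlieBracket_add_left (m cζU) (m cA),
    mlieBracket_add_left (m cζU) (m cA), mlieBracket_const_smul_left (m hA),
    mlieBracket_const_smul_left (m hA)] at sW
  rw [mlieBracket_add_right (m cζY) (m cV), mlieBracket_const_smul_right (m hV.1)] at sQ
  rw [k1, k2, j1, j2] at dUZY
  rw [sP, sQ] at dPQ
  simp only [Pi.add_apply, Pi.smul_apply, map_add, map_smul, add_apply, smul_apply, smul_eq_mul,
    hUV] at sW dUZY dPQ
  change _ = g.inner x _ (Y x) + _
  -- Subtracting the two orders leaves, by Jacobi, the brackets with `[ζ, U]`, which `sW` trades for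
  -- twice those with `φU`, and the term `2g([U, Z], V)`.
  linarith

/-- Expand the brackets of `inner_mlieBracket_φ` by torsion-freeness. The `∇_Z` terms cancel, as `φ`
commutes with `∇_Z` on vertical fields and is isometric there; the `∇_{φU}` terms cancel because `Z`
is orthogonal to `φV`. -/
theorem inner_nabla_φ (hΨ : IsSicSubmersion h S Ψ lam D₁) (hS : S.IsSasakian)
    (hφ : ∀ x, ∀ v ∈ vert 𝓘(ℝ, E) 𝓘(ℝ, E') Ψ x, S.φ x v ∈ hor g 𝓘(ℝ, E') Ψ x)
    (hU : IsSection (vert 𝓘(ℝ, E) 𝓘(ℝ, E') Ψ) U) (hV : IsSection (vert 𝓘(ℝ, E) 𝓘(ℝ, E') Ψ) V)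
    (hZ : IsSection (hor g 𝓘(ℝ, E') Ψ) Z)
    (hZφ : ∀ x, ∀ w ∈ vert 𝓘(ℝ, E) 𝓘(ℝ, E') Ψ x, g.inner x (Z x) (S.φ x w) = 0) (x : M) :
    g.inner x (nabla g (fun y ↦ S.φ y (V y)) Z x) (S.φ x (U x)) =
      -g.inner x (nabla g U V x) (Z x) := by
  have hφU := isSection_φ hφ hU
  have hφV := isSection_φ hφ hV
  have key := hΨ.inner_mlieBracket_φ hS hφ hU hV hZ hZφ x
  have o1 := inner_nabla_of_orthogonal hφU.1 hZ.1 hφV.1 (fun y ↦ hZφ y _ (hV.2 y)) x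
  have o2 := inner_nabla_of_orthogonal hφV.1 hZ.1 hφU.1 (fun y ↦ hZφ y _ (hU.2 y)) x
  have o3 := inner_nabla_of_orthogonal hU.1 hZ.1 hV.1
    (fun y ↦ inner_hor_vert g (hZ.2 y) (hV.2 y)) x
  have e : g.inner x (nabla g Z (fun y ↦ S.φ y (U y)) x) (S.φ x (V x)) =
      g.inner x (nabla g Z U x) (V x) := by
    rw [hS.nabla_φ_apply hZ.1 hU.1, inner_hor_vert g (hZ.2 x) (hU.2 x), hΨ.η_vert (hU.2 x),
      zero_smul, zero_smul, sub_zero, add_zero, S.inner_φ_φ, hΨ.η_vert (hV.2 x), mul_zero, sub_zero]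
  rw [← nabla_sub_nabla (g := g) hU.1 hZ.1, ← nabla_sub_nabla (g := g) hφU.1 hZ.1,
    ← nabla_sub_nabla (g := g) hφU.1 hφV.1] at key
  simp only [map_sub, sub_apply] at key
  rw [g.symm x (nabla g U V x)]
  linarith

theorem φ_mem_D₁ (hΨ : IsSicSubmersion h S Ψ lam D₁) {x : M} {v : TangentSpace 𝓘(ℝ, E) x}
    (hv : v ∈ D₁ x) : S.φ x v ∈ D₁ x := by
  rw [← hΨ.map_D₁ x]
  exact Submodule.mem_map_of_mem hv

theorem exists_add_eq (hΨ : IsSicSubmersion h S Ψ lam D₁) {x : M} {v : TangentSpace 𝓘(ℝ, E) x}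
    (hv : v ∈ vert 𝓘(ℝ, E) 𝓘(ℝ, E') Ψ x) :
    ∃ d ∈ D₁ x, ∃ e ∈ distD₂ g 𝓘(ℝ, E') Ψ D₁ x, d + e = v := by
  have hs : v ∈ D₁ x ⊔ orth g x (D₁ x) := by
    rw [(isCompl_orth g x (D₁ x)).sup_eq_top]
    exact Submodule.mem_top
  obtain ⟨d, hd, e, he, rfl⟩ := Submodule.mem_sup.1 hs
  refine ⟨d, hd, e, ⟨?_, he⟩, rfl⟩
  simpa using Submodule.sub_mem _ hv (hΨ.D₁_le x hd)

theorem φ_mem_hor_of_mem_D₂ (hΨ : IsSicSubmersion h S Ψ lam D₁) {x : M}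
    {v : TangentSpace 𝓘(ℝ, E) x} (hv : v ∈ distD₂ g 𝓘(ℝ, E') Ψ D₁ x) :
    S.φ x v ∈ hor g 𝓘(ℝ, E') Ψ x :=
  hΨ.map_D₂ x (Submodule.mem_map_of_mem hv)

theorem vProj_φ_mem_D₁ (hΨ : IsSicSubmersion h S Ψ lam D₁) {x : M}
    {v : TangentSpace 𝓘(ℝ, E) x} (hv : v ∈ vert 𝓘(ℝ, E) 𝓘(ℝ, E') Ψ x) :
    vProj g 𝓘(ℝ, E') Ψ x (S.φ x v) ∈ D₁ x := by
  obtain ⟨d, hd, e, he, rfl⟩ := hΨ.exists_add_eq hv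
  rw [map_add, map_add, vProj_eq_self g (hΨ.D₁_le x (hΨ.φ_mem_D₁ hd)),
    vProj_eq_zero g (hΨ.φ_mem_hor_of_mem_D₂ he), add_zero]
  exact hΨ.φ_mem_D₁ hd

/-- Only the `D₂` component survives the horizontal projection, and `φ² = -1` on vertical vectors.
-/
theorem φ_hProj_φ_mem_D₂ (hΨ : IsSicSubmersion h S Ψ lam D₁) {x : M}
    {v : TangentSpace 𝓘(ℝ, E) x} (hv : v ∈ vert 𝓘(ℝ, E) 𝓘(ℝ, E') Ψ x) :
    S.φ x (hProj g 𝓘(ℝ, E') Ψ x (S.φ x v)) ∈ distD₂ g 𝓘(ℝ, E') Ψ D₁ x := by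
  obtain ⟨d, hd, e, he, rfl⟩ := hΨ.exists_add_eq hv
  have he' : hProj g 𝓘(ℝ, E') Ψ x (S.φ x e) = S.φ x e :=
    hProj_eq_self g (hΨ.φ_mem_hor_of_mem_D₂ he)
  rw [map_add, map_add, hProj_eq_zero g (hΨ.D₁_le x (hΨ.φ_mem_D₁ hd)), he', zero_add, S.φ_φ,
    hΨ.η_vert he.1, zero_smul, add_zero]
  exact Submodule.neg_mem _ he

end IsSicSubmersion
end SicSubmersion
end

/-! ### Each side of the equivalence forces `D₁ = 0`. -/

noncomputable section
namespace SicSubmersion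

set_option linter.unusedSectionVars false

variable {E : Type*} [NormedAddCommGroup E] [NormedSpace ℝ E] [FiniteDimensional ℝ E]
  {M : Type*} [TopologicalSpace M] [ChartedSpace E M] [IsManifold 𝓘(ℝ, E) ∞ M] [T2Space M]
  {E' : Type*} [NormedAddCommGroup E'] [NormedSpace ℝ E'] [FiniteDimensional ℝ E']
  {N : Type*} [TopologicalSpace N] [ChartedSpace E' N] [IsManifold 𝓘(ℝ, E') ∞ N]
  {g : ContMDiffRiemannianMetric 𝓘(ℝ, E) ∞ E (fun x : M ↦ TangentSpace 𝓘(ℝ, E) x)}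
  {h : ContMDiffRiemannianMetric 𝓘(ℝ, E') ∞ E' (fun y : N ↦ TangentSpace 𝓘(ℝ, E') y)}
  {S : AlmostContactMetricStructure g} {Ψ : M → N} {lam : M → ℝ}
  {D₁ : Π x : M, Submodule ℝ (TangentSpace 𝓘(ℝ, E) x)}
  {U V X Y Z : Π x : M, TangentSpace 𝓘(ℝ, E) x}

section Projections

variable {x : M} {u z : TangentSpace 𝓘(ℝ, E) x}

variable (g) in
theorem inner_hProj_left (u : TangentSpace 𝓘(ℝ, E) x) (hz : z ∈ hor g 𝓘(ℝ, E') Ψ x) :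
    g.inner x (hProj g 𝓘(ℝ, E') Ψ x u) z = g.inner x u z := by
  conv_rhs => rw [← vProj_add_hProj g (Ψ := Ψ) (E' := E') u, map_add, add_apply,
    inner_vert_hor g (vProj_mem g u) hz, zero_add]

variable (g) in
theorem inner_vProj_left (u : TangentSpace 𝓘(ℝ, E) x) (hz : z ∈ vert 𝓘(ℝ, E) 𝓘(ℝ, E') Ψ x) :
    g.inner x (vProj g 𝓘(ℝ, E') Ψ x u) z = g.inner x u z := by
  conv_rhs => rw [← vProj_add_hProj g (Ψ := Ψ) (E' := E') u, map_add, add_apply,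
    inner_hor_vert g (hProj_mem g u) hz, add_zero]

variable (g) in
theorem eq_zero_of_inner_self (hu : g.inner x u u = 0) : u = 0 := by
  by_contra hne
  exact (g.pos x u hne).ne' hu

theorem mem_distMu : z ∈ distMu 𝓘(ℝ, E') S Ψ D₁ x ↔ z ∈ hor g 𝓘(ℝ, E') Ψ x ∧
    ∀ w ∈ distD₂ g 𝓘(ℝ, E') Ψ D₁ x, g.inner x (S.φ x w) z = 0 := by
  rw [distMu, Submodule.mem_inf, mem_orth]
  refine and_congr_right fun _ ↦ ⟨fun H w hw ↦ H _ (Submodule.mem_map_of_mem hw), ?_⟩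
  rintro H _ ⟨w, hw, rfl⟩
  exact H w hw

theorem inner_oneillA (hX : ∀ y, X y ∈ hor g 𝓘(ℝ, E') Ψ y)
    (hY : ∀ y, Y y ∈ vert 𝓘(ℝ, E) 𝓘(ℝ, E') Ψ y) (hz : z ∈ hor g 𝓘(ℝ, E') Ψ x) :
    g.inner x (oneillA g 𝓘(ℝ, E') Ψ X Y x) z = g.inner x (nabla g X Y x) z := by
  have e1 : (fun y ↦ hProj g 𝓘(ℝ, E') Ψ y (X y)) = X := funext fun y ↦ hProj_eq_self g (hX y)
  have e2 : (fun y ↦ vProj g 𝓘(ℝ, E') Ψ y (Y y)) = Y := funext fun y ↦ vProj_eq_self g (hY y)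
  rw [oneillA, e1, e2, map_add, add_apply, inner_hProj_left g _ hz,
    inner_vert_hor g (vProj_mem g _) hz, add_zero]

end Projections

namespace IsSicSubmersion

theorem isSection_vertPart (hΨ : IsSicSubmersion h S Ψ lam D₁) (hX : CMDiff ∞ (T% X)) :
    IsSection (vert 𝓘(ℝ, E) 𝓘(ℝ, E') Ψ) (vertPart 𝓘(ℝ, E') S Ψ X) :=
  ⟨contMDiff_vProj g hΨ.contMDiff hΨ.surjective_mfderiv (S.contMDiff_φ_apply hX),
    fun _ ↦ vProj_mem g _⟩

theorem isSection_horPart (hΨ : IsSicSubmersion h S Ψ lam D₁) (hX : CMDiff ∞ (T% X)) :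
    IsSection (hor g 𝓘(ℝ, E') Ψ) (horPart 𝓘(ℝ, E') S Ψ X) :=
  ⟨contMDiff_hProj g hΨ.contMDiff hΨ.surjective_mfderiv (S.contMDiff_φ_apply hX),
    fun _ ↦ hProj_mem g _⟩

theorem inner_horPart_ζ (hΨ : IsSicSubmersion h S Ψ lam D₁) (x : M) :
    g.inner x (horPart 𝓘(ℝ, E') S Ψ X x) (S.ζ x) = 0 := by
  rw [horPart, inner_hProj_left g _ (hΨ.ζ_mem x), S.inner_ζ, S.η_φ]

/-- Because `η ∘ φ = 0`, the field `ζ` is an admissible test field in condition 1. -/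
theorem isSection_mu_ζ (hΨ : IsSicSubmersion h S Ψ lam D₁) :
    IsSection (distMu 𝓘(ℝ, E') S Ψ D₁) S.ζ :=
  ⟨S.contMDiff_ζ, fun x ↦ mem_distMu.2 ⟨hΨ.ζ_mem x, fun w _ ↦ by rw [S.inner_ζ, S.η_φ]⟩⟩

theorem eq_zero_of_inner_φ_self (hΨ : IsSicSubmersion h S Ψ lam D₁) {x : M}
    {u : TangentSpace 𝓘(ℝ, E) x} (hu : u ∈ vert 𝓘(ℝ, E) 𝓘(ℝ, E') Ψ x)
    (h0 : g.inner x (S.φ x u) (S.φ x u) = 0) : u = 0 := by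
  rw [S.inner_φ_φ, hΨ.η_vert hu, mul_zero, sub_zero] at h0
  exact eq_zero_of_inner_self g h0

/-- Here `0 = g(∇_U V, ζ) = g(V, φU)`, and `V` may take the value `φu`, which is vertical because
`φ` preserves `D₁`. -/
theorem D₁_eq_bot_of_totallyGeodesic (hΨ : IsSicSubmersion h S Ψ lam D₁) (hS : S.IsSasakian)
    (hT : IsVertTotallyGeodesic g 𝓘(ℝ, E') Ψ) (x : M) : D₁ x = ⊥ := by
  refine (Submodule.eq_bot_iff _).2 fun u hu ↦ ?_
  have hφu := hΨ.D₁_le x (hΨ.φ_mem_D₁ hu)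
  obtain ⟨U, hU, hUx⟩ := hΨ.exists_vert_section (hΨ.D₁_le x hu)
  obtain ⟨V, hV, hVx⟩ := hΨ.exists_vert_section hφu
  have h1 := inner_nabla_of_orthogonal hU.1 hV.1 S.contMDiff_ζ
    (fun y ↦ inner_vert_hor g (hV.2 y) (hΨ.ζ_mem y)) x
  rw [inner_vert_hor g (hT U V hU hV x) (hΨ.ζ_mem x), hS.nabla_ζ U hU.1, map_neg, neg_neg, hUx,
    hVx] at h1
  exact hΨ.eq_zero_of_inner_φ_self (hΨ.D₁_le x hu) h1.symm

variable (h S Ψ lam) in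
/-- The condition on `∇^Ψ` for the fields `U`, `V` and `Z` at the point `x`. -/
def PullbackCondition (U V Z : Π x : M, TangentSpace 𝓘(ℝ, E) x) (x : M) : Prop :=
  h.inner (Ψ x)
    (pullbackNabla h Ψ (fun y ↦ mfderiv 𝓘(ℝ, E) 𝓘(ℝ, E') Ψ y (Z y)) x
      (horPart 𝓘(ℝ, E') S Ψ V x))
    (mfderiv 𝓘(ℝ, E) 𝓘(ℝ, E') Ψ x (horPart 𝓘(ℝ, E') S Ψ U x))
  = lam x ^ 2 * g.inner x
    (horPart 𝓘(ℝ, E') S Ψ (oneillT g 𝓘(ℝ, E') Ψ U (vertPart 𝓘(ℝ, E') S Ψ V)) x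
      + oneillA g 𝓘(ℝ, E') Ψ (horPart 𝓘(ℝ, E') S Ψ V) (vertPart 𝓘(ℝ, E') S Ψ U) x
      + g.inner x (horPart 𝓘(ℝ, E') S Ψ V x) (horPart 𝓘(ℝ, E') S Ψ U x)
        • grad g (fun y ↦ Real.log (lam y)) x
      - g.inner x (vertPart 𝓘(ℝ, E') S Ψ U x) (V x) • S.ζ x)
    (Z x)

/-- The condition on `∇^Ψ` with both sides evaluated in terms of the connection of `M`. -/
theorem pullbackCondition_iff (hΨ : IsSicSubmersion h S Ψ lam D₁)
    (hU : CMDiff ∞ (T% U)) (hV : CMDiff ∞ (T% V)) (hZ : IsSection (hor g 𝓘(ℝ, E') Ψ) Z)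
    (hUZ : ∀ y, g.inner y (Z y) (horPart 𝓘(ℝ, E') S Ψ U y) = 0)
    (hVZ : ∀ y, g.inner y (Z y) (horPart 𝓘(ℝ, E') S Ψ V y) = 0) (x : M) :
    PullbackCondition h S Ψ lam U V Z x ↔
      g.inner x (nabla g (horPart 𝓘(ℝ, E') S Ψ V) Z x) (horPart 𝓘(ℝ, E') S Ψ U x) =
        g.inner x (horPart 𝓘(ℝ, E') S Ψ (oneillT g 𝓘(ℝ, E') Ψ U (vertPart 𝓘(ℝ, E') S Ψ V)) x) (Z x)
          + g.inner x
            (nabla g (horPart 𝓘(ℝ, E') S Ψ V) (vertPart 𝓘(ℝ, E') S Ψ U) x) (Z x)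
          - g.inner x (vertPart 𝓘(ℝ, E') S Ψ U x) (V x) * S.η x (Z x) := by
  have hpos : lam x ^ 2 ≠ 0 := (pow_pos (hΨ.lam_pos x) 2).ne'
  rw [PullbackCondition, hΨ.inner_pullbackNabla hΨ.mdiff_sq (hΨ.isSection_horPart hV)
    (hΨ.isSection_horPart hU) hZ (fun y ↦ by rw [g.symm, hVZ]) hUZ, hΨ.mvfderiv_sq]
  simp only [map_add, map_sub, map_smul, add_apply, sub_apply, smul_apply, smul_eq_mul,
    S.inner_ζ_left]
  rw [inner_oneillA (hΨ.isSection_horPart hV).2 (hΨ.isSection_vertPart hU).2 (hZ.2 x)]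
  -- The conformal correction and the `grad ln λ` term coincide and drop out; what is left is
  -- divided by `λ²`.
  refine ⟨fun H ↦ mul_left_cancel₀ hpos ?_, fun H ↦ ?_⟩
  · linear_combination H
  · linear_combination lam x ^ 2 * H

theorem D₁_eq_bot_of_pullbackCondition (hΨ : IsSicSubmersion h S Ψ lam D₁) (hS : S.IsSasakian)
    (hP : ∀ U V : Π x : M, TangentSpace 𝓘(ℝ, E) x,
      IsSection (vert 𝓘(ℝ, E) 𝓘(ℝ, E') Ψ) U → IsSection (vert 𝓘(ℝ, E) 𝓘(ℝ, E') Ψ) V →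
        ∀ x, PullbackCondition h S Ψ lam U V S.ζ x) (x : M) : D₁ x = ⊥ := by
  refine (Submodule.eq_bot_iff _).2 fun u hu ↦ ?_
  have hφu := hΨ.D₁_le x (hΨ.φ_mem_D₁ hu)
  obtain ⟨U, hU, hUx⟩ := hΨ.exists_vert_section (hΨ.D₁_le x hu)
  obtain ⟨V, hV, hVx⟩ := hΨ.exists_vert_section hφu
  have hvU := hΨ.isSection_vertPart hU.1
  have hhV := hΨ.isSection_horPart hV.1
  have hD := hΨ.φ_hProj_φ_mem_D₂ (hV.2 x)
  have h1 := (hΨ.pullbackCondition_iff hU.1 hV.1 hΨ.isSection_ζ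
    (fun y ↦ by rw [g.symm, hΨ.inner_horPart_ζ]) (fun y ↦ by rw [g.symm, hΨ.inner_horPart_ζ])
    x).1 (hP U V hU hV x)
  rw [inner_nabla_of_orthogonal hhV.1 hvU.1 S.contMDiff_ζ
    (fun y ↦ inner_vert_hor g (hvU.2 y) (hΨ.ζ_mem y)), hS.nabla_ζ _ hhV.1, hΨ.inner_horPart_ζ,
    S.η_ζ] at h1
  -- With `Z = ζ` both connection terms reduce to pairings with `φωV`, which lies in `D₂`:
  -- orthogonal to the horizontal `ωU` and to `ϕU` in `D₁`. Only `g(ϕU, V)` survives.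
  have h2 : g.inner x (S.φ x (horPart 𝓘(ℝ, E') S Ψ V x)) (horPart 𝓘(ℝ, E') S Ψ U x) = 0 :=
    inner_vert_hor g hD.1 (hProj_mem g _)
  have h3 : g.inner x (vertPart 𝓘(ℝ, E') S Ψ U x) (S.φ x (horPart 𝓘(ℝ, E') S Ψ V x)) = 0 :=
    (mem_orth g).1 hD.2 _ (hΨ.vProj_φ_mem_D₁ (hU.2 x))
  simp only [map_neg, neg_apply, h2, h3] at h1
  rw [vertPart, hUx, hVx, vProj_eq_self g hφu] at h1
  exact hΨ.eq_zero_of_inner_φ_self (hΨ.D₁_le x hu) (by linarith)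

/-! ### The equivalence when `D₁ = 0`. -/

section AntiInvariant

theorem distD₂_eq_vert (hD : ∀ x, D₁ x = ⊥) (x : M) :
    distD₂ g 𝓘(ℝ, E') Ψ D₁ x = vert 𝓘(ℝ, E) 𝓘(ℝ, E') Ψ x := by
  refine inf_eq_left.2 fun v _ ↦ (mem_orth g).2 fun w hw ↦ ?_
  rw [hD, Submodule.mem_bot] at hw
  rw [hw, map_zero, zero_apply]

theorem φ_mem_hor (hΨ : IsSicSubmersion h S Ψ lam D₁) (hD : ∀ x, D₁ x = ⊥) (x : M)
    (v : TangentSpace 𝓘(ℝ, E) x) (hv : v ∈ vert 𝓘(ℝ, E) 𝓘(ℝ, E') Ψ x) :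
    S.φ x v ∈ hor g 𝓘(ℝ, E') Ψ x := by
  rw [← distD₂_eq_vert (g := g) hD] at hv
  exact hΨ.φ_mem_hor_of_mem_D₂ hv

theorem vertPart_eq_zero (hΨ : IsSicSubmersion h S Ψ lam D₁) (hD : ∀ x, D₁ x = ⊥)
    (hV : IsSection (vert 𝓘(ℝ, E) 𝓘(ℝ, E') Ψ) V) :
    vertPart 𝓘(ℝ, E') S Ψ V = fun _ ↦ 0 :=
  funext fun y ↦ vProj_eq_zero g (hΨ.φ_mem_hor hD y _ (hV.2 y))

theorem horPart_eq (hΨ : IsSicSubmersion h S Ψ lam D₁) (hD : ∀ x, D₁ x = ⊥)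
    (hV : IsSection (vert 𝓘(ℝ, E) 𝓘(ℝ, E') Ψ) V) :
    horPart 𝓘(ℝ, E') S Ψ V = fun y ↦ S.φ y (V y) :=
  funext fun y ↦ hProj_eq_self g (hΨ.φ_mem_hor hD y _ (hV.2 y))

theorem oneillT_zero (x : M) : oneillT g 𝓘(ℝ, E') Ψ X (fun _ ↦ 0) x = 0 := by
  simp only [oneillT, map_zero, nabla_zero, add_zero]

theorem pullbackCondition_iff_inner_nabla (hΨ : IsSicSubmersion h S Ψ lam D₁) (hS : S.IsSasakian)
    (hD : ∀ x, D₁ x = ⊥) (hU : IsSection (vert 𝓘(ℝ, E) 𝓘(ℝ, E') Ψ) U)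
    (hV : IsSection (vert 𝓘(ℝ, E) 𝓘(ℝ, E') Ψ) V) (hZ : IsSection (distMu 𝓘(ℝ, E') S Ψ D₁) Z)
    (x : M) : PullbackCondition h S Ψ lam U V Z x ↔ g.inner x (nabla g U V x) (Z x) = 0 := by
  have hZh : IsSection (hor g 𝓘(ℝ, E') Ψ) Z := ⟨hZ.1, fun y ↦ (mem_distMu.1 (hZ.2 y)).1⟩
  have hZφ : ∀ y, ∀ w ∈ vert 𝓘(ℝ, E) 𝓘(ℝ, E') Ψ y, g.inner y (Z y) (S.φ y w) = 0 :=
    fun y w hw ↦ by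
      rw [g.symm]
      exact (mem_distMu.1 (hZ.2 y)).2 w (by rwa [distD₂_eq_vert hD])
  rw [hΨ.pullbackCondition_iff hU.1 hV.1 hZh
    (fun y ↦ by rw [hΨ.horPart_eq hD hU]; exact hZφ y _ (hU.2 y))
    (fun y ↦ by rw [hΨ.horPart_eq hD hV]; exact hZφ y _ (hV.2 y)),
    hΨ.vertPart_eq_zero hD hU, hΨ.vertPart_eq_zero hD hV, hΨ.horPart_eq hD hU,
    hΨ.horPart_eq hD hV, hΨ.inner_nabla_φ hS (hΨ.φ_mem_hor hD) hU hV hZh hZφ]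
  simp only [horPart, oneillT_zero, nabla_zero, map_zero, zero_apply, zero_mul, add_zero,
    sub_zero, neg_eq_zero]

/-- The left side reduces to `𝓥 ∇_U (φV) = 0`, and `∇_U (φV)` differs from `φ ∇_U V` by a multiple
of the horizontal field `ζ`. -/
theorem fiber_condition_iff (hΨ : IsSicSubmersion h S Ψ lam D₁) (hS : S.IsSasakian)
    (hD : ∀ x, D₁ x = ⊥) (hU : IsSection (vert 𝓘(ℝ, E) 𝓘(ℝ, E') Ψ) U)
    (hV : IsSection (vert 𝓘(ℝ, E) 𝓘(ℝ, E') Ψ) V) (x : M) :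
    oneillT g 𝓘(ℝ, E') Ψ U (horPart 𝓘(ℝ, E') S Ψ V) x
        + nablaHat g 𝓘(ℝ, E') Ψ U (vertPart 𝓘(ℝ, E') S Ψ V) x ∈ D₁ x ↔
      vProj g 𝓘(ℝ, E') Ψ x (S.φ x (nabla g U V x)) = 0 := by
  have hφ := hΨ.φ_mem_hor hD
  have e1 : (fun y ↦ vProj g 𝓘(ℝ, E') Ψ y (U y)) = U :=
    funext fun y ↦ vProj_eq_self g (hU.2 y)
  have e2 : (fun y ↦ vProj g 𝓘(ℝ, E') Ψ y (S.φ y (V y))) = fun _ ↦ 0 :=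
    funext fun y ↦ vProj_eq_zero g (hφ y _ (hV.2 y))
  have e3 : (fun y ↦ hProj g 𝓘(ℝ, E') Ψ y (S.φ y (V y))) = fun y ↦ S.φ y (V y) :=
    funext fun y ↦ hProj_eq_self g (hφ y _ (hV.2 y))
  rw [hD, Submodule.mem_bot, hΨ.vertPart_eq_zero hD hV, hΨ.horPart_eq hD hV, oneillT, nablaHat,
    e1, e2, e3, nabla_zero, map_zero, map_zero, zero_add, add_zero, hS.nabla_φ_apply hU.1 hV.1,
    hΨ.η_vert (hV.2 x), zero_smul, sub_zero, map_add, map_smul, vProj_eq_zero g (hΨ.ζ_mem x),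
    smul_zero, add_zero]

/-- For horizontal `X`, the field `X + φ 𝓥 φ X` is its projection to `μ`: pairing with `φw` gives
`g(φw, X) + g(w, φX) = 0`. The hypothesis makes the correction vanish at `x`. -/
theorem exists_mu_section (hΨ : IsSicSubmersion h S Ψ lam D₁) (hD : ∀ x, D₁ x = ⊥) {x : M}
    {t : TangentSpace 𝓘(ℝ, E) x} (ht : t ∈ hor g 𝓘(ℝ, E') Ψ x)
    (htφ : vProj g 𝓘(ℝ, E') Ψ x (S.φ x t) = 0) :
    ∃ Z, IsSection (distMu 𝓘(ℝ, E') S Ψ D₁) Z ∧ Z x = t := by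
  obtain ⟨X, hX, rfl⟩ := hΨ.exists_hor_section ht
  have hv := hΨ.isSection_vertPart (S := S) hX.1
  refine ⟨X + fun y ↦ S.φ y (vertPart 𝓘(ℝ, E') S Ψ X y),
    ⟨hX.1.add_section (S.contMDiff_φ_apply hv.1), fun y ↦ mem_distMu.2 ⟨?_, fun w hw ↦ ?_⟩⟩, ?_⟩
  · exact Submodule.add_mem _ (hX.2 y) (hΨ.φ_mem_hor hD y _ (hv.2 y))
  · have e := inner_vProj_left g (S.φ y (X y)) hw.1
    rw [Pi.add_apply, map_add, S.inner_φ_φ, hΨ.η_vert hw.1, zero_mul, sub_zero, g.symm y w,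
      vertPart, e, S.inner_φ y (X y), g.symm, add_neg_cancel]
  · rw [Pi.add_apply, vertPart, htφ, map_zero, add_zero]

theorem totallyGeodesic_iff (hΨ : IsSicSubmersion h S Ψ lam D₁) (hS : S.IsSasakian)
    (hD : ∀ x, D₁ x = ⊥) :
    IsVertTotallyGeodesic g 𝓘(ℝ, E') Ψ ↔
      (∀ U V Z : Π x : M, TangentSpace 𝓘(ℝ, E) x,
        IsSection (vert 𝓘(ℝ, E) 𝓘(ℝ, E') Ψ) U → IsSection (vert 𝓘(ℝ, E) 𝓘(ℝ, E') Ψ) V →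
        IsSection (distMu 𝓘(ℝ, E') S Ψ D₁) Z → ∀ x, PullbackCondition h S Ψ lam U V Z x)
      ∧ ∀ U V : Π x : M, TangentSpace 𝓘(ℝ, E) x,
        IsSection (vert 𝓘(ℝ, E) 𝓘(ℝ, E') Ψ) U → IsSection (vert 𝓘(ℝ, E) 𝓘(ℝ, E') Ψ) V →
        ∀ x, oneillT g 𝓘(ℝ, E') Ψ U (horPart 𝓘(ℝ, E') S Ψ V) x
          + nablaHat g 𝓘(ℝ, E') Ψ U (vertPart 𝓘(ℝ, E') S Ψ V) x ∈ D₁ x := by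
  refine ⟨fun hT ↦ ⟨fun U V Z hU hV hZ x ↦ ?_, fun U V hU hV x ↦ ?_⟩,
    fun ⟨h1, h2⟩ U V hU hV x ↦ ?_⟩
  · exact (hΨ.pullbackCondition_iff_inner_nabla hS hD hU hV hZ x).2
      (inner_vert_hor g (hT U V hU hV x) (mem_distMu.1 (hZ.2 x)).1)
  · exact (hΨ.fiber_condition_iff hS hD hU hV x).2
      (vProj_eq_zero g (hΨ.φ_mem_hor hD x _ (hT U V hU hV x)))
  · have h3 := (hΨ.fiber_condition_iff hS hD hU hV x).1 (h2 U V hU hV x)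
    set n := nabla g U V x with hn
    have hsplit := vProj_add_hProj g (Ψ := Ψ) (E' := E') n
    -- The vertical part of `∇_U V` has horizontal image under `φ`, so condition 2 constrains only
    -- the horizontal part. That part then lies in `μ`, and taking it as the value of `Z` in
    -- condition 1 shows its norm is zero.
    have htφ : vProj g 𝓘(ℝ, E') Ψ x (S.φ x (hProj g 𝓘(ℝ, E') Ψ x n)) = 0 := by
      rw [← hsplit, map_add, map_add,
        vProj_eq_zero g (hΨ.φ_mem_hor hD x _ (vProj_mem g n)), zero_add] at h3
      exact h3
    obtain ⟨Z, hZ, hZx⟩ := hΨ.exists_mu_section hD (hProj_mem g n) htφ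
    have h4 := (hΨ.pullbackCondition_iff_inner_nabla hS hD hU hV hZ x).1 (h1 U V Z hU hV hZ x)
    rw [hZx, ← hn, ← inner_hProj_left g n (hProj_mem g n)] at h4
    rw [← hsplit, eq_zero_of_inner_self g h4, add_zero]
    exact vProj_mem g n

end AntiInvariant

end IsSicSubmersion
end SicSubmersion
end

theorem mainTheorem7
    {E : Type*} [NormedAddCommGroup E] [NormedSpace ℝ E] [FiniteDimensional ℝ E]
    {M : Type*} [TopologicalSpace M] [ChartedSpace E M] [IsManifold 𝓘(ℝ, E) ∞ M]
    [T2Space M] [SecondCountableTopology M]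
    {E' : Type*} [NormedAddCommGroup E'] [NormedSpace ℝ E'] [FiniteDimensional ℝ E']
    {N : Type*} [TopologicalSpace N] [ChartedSpace E' N] [IsManifold 𝓘(ℝ, E') ∞ N]
    [T2Space N] [SecondCountableTopology N]
    (gm : ContMDiffRiemannianMetric 𝓘(ℝ, E) ∞ E (fun x : M ↦ TangentSpace 𝓘(ℝ, E) x))
    (gn : ContMDiffRiemannianMetric 𝓘(ℝ, E') ∞ E' (fun y : N ↦ TangentSpace 𝓘(ℝ, E') y))
    (S : AlmostContactMetricStructure gm) (hS : S.IsSasakian)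
    (Ψ : M → N) (lam : M → ℝ) (D₁ : Π x : M, Submodule ℝ (TangentSpace 𝓘(ℝ, E) x))
    (hΨ : IsSicSubmersion gn S Ψ lam D₁) :
    IsVertTotallyGeodesic gm 𝓘(ℝ, E') Ψ ↔
      (∀ U V Z : Π x : M, TangentSpace 𝓘(ℝ, E) x,
        IsSection (vert 𝓘(ℝ, E) 𝓘(ℝ, E') Ψ) U → IsSection (vert 𝓘(ℝ, E) 𝓘(ℝ, E') Ψ) V →
        IsSection (distMu 𝓘(ℝ, E') S Ψ D₁) Z →
        ∀ x : M,
          gn.inner (Ψ x)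
            (pullbackNabla gn Ψ (fun y ↦ mfderiv 𝓘(ℝ, E) 𝓘(ℝ, E') Ψ y (Z y)) x
              (horPart 𝓘(ℝ, E') S Ψ V x))
            (mfderiv 𝓘(ℝ, E) 𝓘(ℝ, E') Ψ x (horPart 𝓘(ℝ, E') S Ψ U x))
          = lam x ^ 2 * gm.inner x
            (horPart 𝓘(ℝ, E') S Ψ (oneillT gm 𝓘(ℝ, E') Ψ U (vertPart 𝓘(ℝ, E') S Ψ V)) x
              + oneillA gm 𝓘(ℝ, E') Ψ (horPart 𝓘(ℝ, E') S Ψ V) (vertPart 𝓘(ℝ, E') S Ψ U) x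
              + gm.inner x (horPart 𝓘(ℝ, E') S Ψ V x) (horPart 𝓘(ℝ, E') S Ψ U x)
                • grad gm (fun y ↦ Real.log (lam y)) x
              - gm.inner x (vertPart 𝓘(ℝ, E') S Ψ U x) (V x) • S.ζ x)
            (Z x))
      ∧ (∀ U V : Π x : M, TangentSpace 𝓘(ℝ, E) x,
        IsSection (vert 𝓘(ℝ, E) 𝓘(ℝ, E') Ψ) U → IsSection (vert 𝓘(ℝ, E) 𝓘(ℝ, E') Ψ) V →
        ∀ x : M,
          oneillT gm 𝓘(ℝ, E') Ψ U (horPart 𝓘(ℝ, E') S Ψ V) x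
            + nablaHat gm 𝓘(ℝ, E') Ψ U (vertPart 𝓘(ℝ, E') S Ψ V) x ∈ D₁ x) := by
  refine ⟨fun hT ↦ ?_, fun hC ↦ ?_⟩
  · exact (hΨ.totallyGeodesic_iff hS (hΨ.D₁_eq_bot_of_totallyGeodesic hS hT)).1 hT
  · exact (hΨ.totallyGeodesic_iff hS (hΨ.D₁_eq_bot_of_pullbackCondition hS
      fun U V hU hV x ↦ hC.1 U V S.ζ hU hV hΨ.isSection_mu_ζ x)).2 hC
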